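/- For $x\in\mathbb{C}^n$, $x\neq 0$, let $\mathcal{D}_x$ be the distribution on the index set of $x$ with $\mathcal{D}_x(i)=|x(i)|^2/\|x\|^2$. For $A\in\mathbb{C}^{m\times n}$, $A\ne 0$, let $k=\mathrm{rank}(A)$, let $A^{-1}$ be the Moore-Penrose pseudo-inverse, $\|A\|$ the spectral norm, $\|A\|_F$ the Frobenius norm, and $\kappa=\|A\|/\sigma_{\min}(A)$ the condition number, where $\sigma_{\min}(A)$ is the smallest nonzero singular value. Let $b\in\mathbb{C}^m$. Algorithms are programs for a randomized random-access machine with unit-cost exact arithmetic, square roots and comparisons of numbers and with biased coins. They can access $A$ and $b$ only as follows: (i) read an entry $A(i,j)$, a row norm $\|A(i,\cdot)\|$, or $\|A\|_F$; (ii) sample a row index $i$ with probability $\|A(i,\cdot)\|^2/\|A\|_F^2$; (iii) for a given $i$ with $A(i,\cdot)\neq 0$, sample a column index from $\mathcal{D}_{A(i,\cdot)}$; (iv) read an entry $b(i)$ or $\|b\|$; (v) sample an index from $\mathcal{D}_b$. Each such access counts as one query and takes time $(\lfloor\log_2(mn)\rfloor+1)^2$. Theorem. There is one algorithm with the following property.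 Let $A$ and $b\ne0$ be given through the access above, let $\varepsilon>0$, $0<\delta<1$, and let $\gamma>0$ be a threshold such that the part of $b$ in the column space of $A$ satisfies $\|AA^{-1}b\|\geq\gamma\|b\|$ (if $b$ lies in the column space of $A$, then $\gamma=1$ is allowed). On input $m,n,k,\kappa,\gamma,\varepsilon,\delta$ the algorithm succeeds with probability at least $1-\delta$ (otherwise it reports failure), and conditioned on success its output has a distribution that is $\varepsilon$-close to $\mathcal{D}_{A^{-1}b}$ in total variation distance $\frac12\sum_i|p(i)-q(i)|$. In every run it uses at most $$\mathrm{poly}\left(k,\kappa,\|A\|_F,\frac1\varepsilon,\frac1\gamma\right)\,\mathrm{polylog}(m,n)\,\log\frac2\delta$$ queries and time, where poly and polylog are fixed polynomials in the listed arguments and in $\log m,\log n$, respectively. -/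

import Mathlib

open scoped Matrix NNReal ENNReal

noncomputable section

/-! ## Linear algebra -/

/-- The Euclidean norm of a complex vector. -/
def l2norm {d : ℕ} (v : Fin d → ℂ) : ℝ := √(∑ i, ‖v i‖ ^ 2)

/-- The Frobenius norm of a complex matrix. -/
def frobNorm {m n : ℕ} (A : Matrix (Fin m) (Fin n) ℂ) : ℝ := √(∑ i, ∑ j, ‖A i j‖ ^ 2)

/-- The spectral norm: the operator norm for the Euclidean norms. -/
def specNorm {m n : ℕ} (A : Matrix (Fin m) (Fin n) ℂ) : ℝ :=
  ‖LinearMap.toContinuousLinearMap (Matrix.toEuclideanLin A)‖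

/-- The smallest nonzero singular value (of a nonzero matrix). Mathlib lists the singular values in
decreasing order from index `0` on, and exactly the first `rank A` of them are nonzero. -/
def sigmaMin {m n : ℕ} (A : Matrix (Fin m) (Fin n) ℂ) : ℝ :=
  (Matrix.toEuclideanLin A).singularValues (A.rank - 1)

/-- The condition number `‖A‖ / σ_min(A)`. -/
def condNumber {m n : ℕ} (A : Matrix (Fin m) (Fin n) ℂ) : ℝ := specNorm A / sigmaMin A

/-- The Moore-Penrose pseudo-inverse `∑ σ_i⁻¹ v_i u_i†`, the sum being over the nonzero singular
values. Here the `v_i` are orthonormal eigenvectors of `A†A` with eigenvalues `σ_i ^ 2` and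
`u_i = A v_i / σ_i`, so the sum is `∑ (σ_i ^ 2)⁻¹ v_i v_i† A†` (recall `0⁻¹ = 0`). -/
def pinv {m n : ℕ} (A : Matrix (Fin m) (Fin n) ℂ) : Matrix (Fin n) (Fin m) ℂ :=
  let hA := Matrix.isHermitian_conjTranspose_mul_self A
  (hA.eigenvectorUnitary : Matrix (Fin n) (Fin n) ℂ) *
    Matrix.diagonal (fun i => ((hA.eigenvalues i)⁻¹ : ℂ)) *
    (hA.eigenvectorUnitary : Matrix (Fin n) (Fin n) ℂ)ᴴ * Aᴴ

open scoped ComplexOrder in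
/-- `pinv A` satisfies the four Penrose equations, which characterize the pseudo-inverse. -/
theorem pinv_penrose {m n : ℕ} (A : Matrix (Fin m) (Fin n) ℂ) :
    A * pinv A * A = A ∧ pinv A * A * pinv A = pinv A ∧
      (A * pinv A)ᴴ = A * pinv A ∧ (pinv A * A)ᴴ = pinv A * A := by
  let hA := Matrix.isHermitian_conjTranspose_mul_self A
  set U : Matrix (Fin n) (Fin n) ℂ := (hA.eigenvectorUnitary : Matrix (Fin n) (Fin n) ℂ) with hU
  set E : Matrix (Fin n) (Fin n) ℂ := Matrix.diagonal (fun i => (hA.eigenvalues i : ℂ)) with hE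
  set J : Matrix (Fin n) (Fin n) ℂ := Matrix.diagonal (fun i => ((hA.eigenvalues i)⁻¹ : ℂ)) with hJ
  have hUU : Uᴴ * U = 1 := by
    have := Unitary.coe_star_mul_self hA.eigenvectorUnitary
    simpa [Matrix.star_eq_conjTranspose] using this
  have hN : Aᴴ * A = U * E * Uᴴ := by
    have := hA.spectral_theorem
    rw [Unitary.conjStarAlgAut_apply] at this
    exact this
  have hJEJ : J * E * J = J := by
    simp only [hJ, hE, Matrix.diagonal_mul_diagonal]
    congr 1; ext i
    by_cases h : (hA.eigenvalues i : ℂ) = 0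
    · simp [h]
    · field_simp
  have hEJE : E * J * E = E := by
    simp only [hJ, hE, Matrix.diagonal_mul_diagonal]
    congr 1; ext i
    by_cases h : (hA.eigenvalues i : ℂ) = 0
    · simp [h]
    · field_simp
  have hJE : (J * E)ᴴ = J * E := by
    simp only [hJ, hE, Matrix.diagonal_mul_diagonal, Matrix.diagonal_conjTranspose]
    congr 1; ext i
    simp
  have hJs : Jᴴ = J := by
    simp only [hJ, Matrix.diagonal_conjTranspose]
    congr 1; ext i
    simp
  have hX : pinv A = U * J * Uᴴ * Aᴴ := rfl
  have hXA : pinv A * A = U * (J * E) * Uᴴ := by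
    calc pinv A * A = U * J * Uᴴ * (Aᴴ * A) := by rw [hX]; simp only [Matrix.mul_assoc]
      _ = U * J * (Uᴴ * U) * E * Uᴴ := by rw [hN]; simp only [Matrix.mul_assoc]
      _ = U * (J * E) * Uᴴ := by rw [hUU]; simp only [Matrix.mul_assoc, Matrix.one_mul]
  refine ⟨?_, ?_, ?_, ?_⟩
  · have key : Aᴴ * A * (pinv A * A - 1) = 0 := by
      rw [Matrix.mul_sub, Matrix.mul_one, hXA, hN]
      have : U * E * Uᴴ * (U * (J * E) * Uᴴ) = U * (E * J * E) * Uᴴ := by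
        calc _ = U * E * (Uᴴ * U) * (J * E) * Uᴴ := by simp only [Matrix.mul_assoc]
          _ = _ := by rw [hUU]; simp only [Matrix.mul_assoc, Matrix.one_mul]
      rw [this, hEJE, sub_self]
    have h2 := (Matrix.conjTranspose_mul_self_mul_eq_zero A _).1 key
    rw [Matrix.mul_sub, Matrix.mul_one, sub_eq_zero] at h2
    rw [Matrix.mul_assoc]; exact h2
  · rw [hXA, hX]
    calc U * (J * E) * Uᴴ * (U * J * Uᴴ * Aᴴ)
        = U * (J * E) * (Uᴴ * U) * J * Uᴴ * Aᴴ := by simp only [Matrix.mul_assoc]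
      _ = U * (J * E * J) * Uᴴ * Aᴴ := by rw [hUU]; simp only [Matrix.mul_assoc, Matrix.one_mul]
      _ = U * J * Uᴴ * Aᴴ := by rw [hJEJ]
  · rw [hX]
    simp only [Matrix.conjTranspose_mul, Matrix.conjTranspose_conjTranspose, hJs, Matrix.mul_assoc]
  · rw [hXA, Matrix.conjTranspose_mul, Matrix.conjTranspose_mul, hJE,
      Matrix.conjTranspose_conjTranspose, ← Matrix.mul_assoc]

/-- `𝒟_x`: the distribution on the index set of `x ≠ 0` with probabilities `|x(i)|² / ‖x‖²`. -/
def sqDist {d : ℕ} (x : Fin d → ℂ) (i : Fin d) : ℝ := ‖x i‖ ^ 2 / l2norm x ^ 2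

/-- Total variation distance `½ ∑ |p(i) - q(i)|`. -/
def tvDist {d : ℕ} (p q : Fin d → ℝ) : ℝ := 1 / 2 * ∑ i, |p i - q i|

/-! ## Sampling primitives -/

open Classical in
/-- A random index, drawn with probabilities proportional to the weights `w`
(index `0` if all weights vanish). -/
def weightedIndex {d : ℕ} (w : Fin d → ℝ≥0) : PMF ℕ :=
  if h : (∑' i, (w i : ℝ≥0∞)) = 0 then PMF.pure 0
    else (PMF.normalize (fun i => (w i : ℝ≥0∞)) h
      (by rw [tsum_fintype]; exact ENNReal.sum_ne_top.2 fun i _ => ENNReal.coe_ne_top)).map Fin.val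

/-- A biased coin: `1` with probability `p` (clamped to `[0, 1]`), otherwise `0`. -/
def biasedCoin (p : ℝ) : PMF ℕ :=
  weightedIndex (![1 - min p.toNNReal 1, min p.toNNReal 1] : Fin 2 → ℝ≥0)

/-! ## Randomized random-access machines

The machine has two memories, both addressed by natural numbers: one for natural numbers (indices,
counters, addresses) and one for complex numbers. It has unit-cost exact arithmetic, square roots and
comparisons, biased coins, and access to `A` and `b` only through the queries and samples listed
below. There is no conversion from complex numbers to natural numbers. A program is a finite
expression whose only constants are natural numbers and the imaginary unit. Indices into `A` and `b`
start from `0`. -/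

namespace RAM

/-- A memory state, together with the time and the number of queries used so far. -/
structure State where
  idx : ℕ → ℕ
  num : ℕ → ℂ
  time : ℕ
  queries : ℕ

/-- Expressions for natural numbers; `load a` reads the index memory at address `a`. -/
inductive IExp
  | const (c : ℕ)
  | load (a : IExp)
  | add (e f : IExp)
  | sub (e f : IExp)
  | mul (e f : IExp)

/-- Value of an expression (`sub` is truncated subtraction). -/
def IExp.eval (s : State) : IExp → ℕ
  | const c => c
  | load a => s.idx (a.eval s)
  | add e f => e.eval s + f.eval s
  | sub e f => e.eval s - f.eval s
  | mul e f => e.eval s * f.eval s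

/-- Number of operations needed to evaluate an expression. -/
def IExp.cost : IExp → ℕ
  | const _ => 1
  | load a => a.cost + 1
  | add e f => e.cost + f.cost + 1
  | sub e f => e.cost + f.cost + 1
  | mul e f => e.cost + f.cost + 1

/-- Expressions for complex numbers; `load a` reads the number memory at address `a`. -/
inductive NExp
  | load (a : IExp)
  | ofIdx (e : IExp)
  | imag
  | add (e f : NExp)
  | sub (e f : NExp)
  | mul (e f : NExp)
  | div (e f : NExp)
  | conj (e : NExp)
  | sqrt (e : NExp)

/-- Value of an expression; `sqrt` is the real square root of the real part. -/
def NExp.eval (s : State) : NExp → ℂ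
  | load a => s.num (a.eval s)
  | ofIdx e => (e.eval s : ℂ)
  | imag => Complex.I
  | add e f => e.eval s + f.eval s
  | sub e f => e.eval s - f.eval s
  | mul e f => e.eval s * f.eval s
  | div e f => e.eval s / f.eval s
  | conj e => (starRingEnd ℂ) (e.eval s)
  | sqrt e => (√(e.eval s).re : ℂ)

/-- Number of operations needed to evaluate an expression. -/
def NExp.cost : NExp → ℕ
  | load a => a.cost + 1
  | ofIdx e => e.cost + 1
  | imag => 1
  | add e f => e.cost + f.cost + 1
  | sub e f => e.cost + f.cost + 1
  | mul e f => e.cost + f.cost + 1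
  | div e f => e.cost + f.cost + 1
  | conj e => e.cost + 1
  | sqrt e => e.cost + 1

/-- Tests: comparison of natural numbers, comparison of real parts of complex numbers, negation. -/
inductive Test
  | ltIdx (e f : IExp)
  | ltNum (e f : NExp)
  | not (t : Test)

/-- Truth of a test. -/
def Test.holds (s : State) : Test → Prop
  | ltIdx e f => e.eval s < f.eval s
  | ltNum e f => (e.eval s).re < (f.eval s).re
  | not t => ¬ t.holds s

/-- Number of operations needed to evaluate a test. -/
def Test.cost : Test → ℕ
  | ltIdx e f => e.cost + f.cost + 1
  | ltNum e f => e.cost + f.cost + 1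
  | not t => t.cost + 1

/-- Deterministic queries: an entry of `A`, the norm of a row of `A`, the Frobenius norm of `A`,
an entry of `b`, the norm of `b`. -/
inductive Query
  | entryA (i j : IExp)
  | rowNormA (i : IExp)
  | frobNormA
  | entryB (i : IExp)
  | normB

/-- Sampling: a row index of `A` with probability `‖A(i,·)‖² / ‖A‖_F²`, a column index from
`𝒟_{A(i,·)}` for a given row `i`, an index from `𝒟_b`. -/
inductive Sample
  | rowA
  | inRowA (i : IExp)
  | indexB

/-- Number of operations needed to compute the arguments of a query. -/
def Query.cost : Query → ℕ
  | entryA i j => i.cost + j.cost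
  | rowNormA i => i.cost
  | frobNormA => 0
  | entryB i => i.cost
  | normB => 0

/-- Number of operations needed to compute the arguments of a sampling instruction. -/
def Sample.cost : Sample → ℕ
  | rowA => 0
  | inRowA i => i.cost
  | indexB => 0

/-- The answer to a query (`0` if an index is out of range). -/
def Query.answer {m n : ℕ} (A : Matrix (Fin m) (Fin n) ℂ) (b : Fin m → ℂ) (s : State) : Query → ℂ
  | entryA i j =>
      if h : i.eval s < m ∧ j.eval s < n then A ⟨i.eval s, h.1⟩ ⟨j.eval s, h.2⟩ else 0
  | rowNormA i => if h : i.eval s < m then (l2norm (A ⟨i.eval s, h⟩) : ℂ) else 0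
  | frobNormA => (frobNorm A : ℂ)
  | entryB i => if h : i.eval s < m then b ⟨i.eval s, h⟩ else 0
  | normB => (l2norm b : ℂ)

/-- The law of the answer to a sampling instruction (`0` if an index is out of range or if the
vector to sample from is zero). -/
def Sample.law {m n : ℕ} (A : Matrix (Fin m) (Fin n) ℂ) (b : Fin m → ℂ) (s : State) :
    Sample → PMF ℕ
  | rowA => weightedIndex (fun i => ∑ j, ‖A i j‖₊ ^ 2)
  | inRowA i =>
      if h : i.eval s < m then weightedIndex (fun j => ‖A ⟨i.eval s, h⟩ j‖₊ ^ 2) else PMF.pure 0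
  | indexB => weightedIndex (fun i => ‖b i‖₊ ^ 2)

/-- Time charged for one access to `A` or `b`: with the standard binary-tree data structures this is
quadratic in the bit length of an address. -/
def accessTime (m n : ℕ) : ℕ := (Nat.log 2 (m * n) + 1) ^ 2

/-- Programs. -/
inductive Cmd
  | skip
  | setIdx (a e : IExp)
  | setNum (a : IExp) (e : NExp)
  | flip (a : IExp) (p : NExp)
  | query (a : IExp) (q : Query)
  | sample (a : IExp) (q : Sample)
  | seq (c d : Cmd)
  | cond (t : Test) (c d : Cmd)
  | loop (t : Test) (c : Cmd)

/-- Charge `t` units of time. -/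
def State.tick (s : State) (t : ℕ) : State := { s with time := s.time + t }

/-- Count one query or sample. -/
def State.count (s : State) : State := { s with queries := s.queries + 1 }

/-- Write into the index memory. -/
def State.writeIdx (s : State) (a v : ℕ) : State := { s with idx := Function.update s.idx a v }

/-- Write into the number memory. -/
def State.writeNum (s : State) (a : ℕ) (z : ℂ) : State :=
  { s with num := Function.update s.num a z }

/-- Sequential composition of computations that may have run out of fuel (`none`). -/
def andThen (μ : PMF (Option State)) (f : State → PMF (Option State)) : PMF (Option State) :=
  μ.bind fun o => o.elim (PMF.pure none) f

open Classical in
/-- While loop with at most `fuel` evaluations of the test; `none` if these do not suffice. -/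
def runLoop (t : Test) (body : State → PMF (Option State)) : ℕ → State → PMF (Option State)
  | 0, _ => PMF.pure none
  | fuel + 1, s =>
      if t.holds s then andThen (body (s.tick t.cost)) (runLoop t body fuel)
      else PMF.pure (some (s.tick t.cost))

open Classical in
/-- The law of the final state of a program; `none` stands for a run in which some loop is not
finished after `fuel` evaluations of its test. -/
def exec {m n : ℕ} (A : Matrix (Fin m) (Fin n) ℂ) (b : Fin m → ℂ) (fuel : ℕ) :
    Cmd → State → PMF (Option State)
  | .skip, s => PMF.pure (some (s.tick 1))
  | .setIdx a e, s =>
      PMF.pure (some ((s.writeIdx (a.eval s) (e.eval s)).tick (a.cost + e.cost + 1)))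
  | .setNum a e, s =>
      PMF.pure (some ((s.writeNum (a.eval s) (e.eval s)).tick (a.cost + e.cost + 1)))
  | .flip a p, s =>
      (biasedCoin (p.eval s).re).map fun v =>
        some ((s.writeIdx (a.eval s) v).tick (a.cost + p.cost + 1))
  | .query a q, s =>
      PMF.pure (some (((s.writeNum (a.eval s) (q.answer A b s)).tick
        (a.cost + q.cost + accessTime m n)).count))
  | .sample a q, s =>
      (q.law A b s).map fun v =>
        some (((s.writeIdx (a.eval s) v).tick (a.cost + q.cost + accessTime m n)).count)
  | .seq c d, s => andThen (exec A b fuel c s) (exec A b fuel d)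
  | .cond t c d, s =>
      if t.holds s then exec A b fuel c (s.tick t.cost) else exec A b fuel d (s.tick t.cost)
  | .loop t c, s => runLoop t (exec A b fuel c) fuel s

/-- The program surely terminates from `s`, and `μ` is the law of its final state. -/
def Terminates {m n : ℕ} (A : Matrix (Fin m) (Fin n) ℂ) (b : Fin m → ℂ) (c : Cmd) (s : State)
    (μ : PMF State) : Prop :=
  ∃ fuel, exec A b fuel c s = μ.map some

/-- The initial state: index cells `0, 1, 2` hold `m`, `n`, `k`, number cells `0, 1, 2, 3` hold
`κ`, `γ`, `ε`, `δ`, and everything else is `0`. -/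
def start (m n k : ℕ) (κ γ ε δ : ℝ) : State where
  idx := fun a => if a = 0 then m else if a = 1 then n else if a = 2 then k else 0
  num := fun a =>
    if a = 0 then κ else if a = 1 then γ else if a = 2 then ε else if a = 3 then δ else 0
  time := 0
  queries := 0

open Classical in
/-- The output: index cell `0` tells whether the run is successful (nonzero) or reports failure,
index cell `1` holds the index that is output. An index out of range counts as failure. -/
def output (n : ℕ) (s : State) : Option (Fin n) :=
  if h : s.idx 0 ≠ 0 ∧ s.idx 1 < n then some ⟨s.idx 1, h.2⟩ else none

/-- Probability that a random output is not a failure. -/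
def successProb {n : ℕ} (law : PMF (Option (Fin n))) : ℝ := ∑ j, (law (some j)).toReal

/-- Probabilities of the outputs, conditioned on success. -/
def successLaw {n : ℕ} (law : PMF (Option (Fin n))) (j : Fin n) : ℝ :=
  (law (some j)).toReal / successProb law

end RAM

end

/-!
The algorithm is stochastic gradient descent for the least-squares problem, followed by rejection
sampling; no matrix is ever inverted.

Let `x⋆ = pinv A *ᵥ b`. Draw a row `r` by its squared norm and a column `j` from `𝒟` of that row,
and add `c (b r / ‖A r‖² - x j / conj (A r j))` times the conjugated row `A r` to the iterate `x`.
In expectation this is a step `c / ‖A‖_F²` along `Aᴴ (b - A x)` (`sum_pairProb_mul_stepCoef`), and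
its second moment is at most `2 c² (‖x‖² + ‖b‖² / ‖A‖_F²)` (`sum_pairProb_mul_stepCoef_sq_le`). The
error stays in the row space, where `‖A‖_F² ‖v‖² ≤ K ‖A v‖²` with `K = rank(A) κ²`
(`frobNorm_sq_mul_le`). Hence the expected squared error contracts by the factor `1 - c / K` per
step up to noise of order `θ c² ‖x⋆‖²`, where `θ = 1 / γ²` (`tapeExp_error_le`). A small step size
`c` makes the error as small as desired after polynomially many steps; no averaging is needed.

After `N` steps the iterate is an explicit combination of the `N` sampled rows, so an entry of it
costs `O(N)` queries. To sample from the squared moduli `‖x j‖²`, propose `j` from `𝒟` of a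
uniformly random sampled row and accept with probability `‖x j‖² / (L * profile j)`, where
`profile j / N` is the probability of the proposal. By Cauchy-Schwarz (`norm_iter_sq_le`) that ratio
is at most `1` unless the sum of the squared lengths of the steps exceeds `L`, which is unlikely by Markov's
inequality. The normalization `L` does not depend on the random iterate. So the law of the output
of an attempt is the *expectation* of `min (‖x j‖²) (L * profile j)` over all runs, divided by `N L`
(`toReal_attemptLaw_some`), and second-moment bounds suffice to compare it with `‖x⋆ j‖²`
(`sum_abs_tapeExp_cutWeight_sub_le`).

An attempt succeeds with probability at least a known `q`, an inverse polynomial. Independent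
repetition until the first success leaves the conditional law unchanged, and about `log (1 / δ) / q`
attempts push the failure probability below `δ` (`repeatLaw_attemptLaw_spec`).

The program is related to these laws by a relational program logic: `RAM.Sim M ρ R` says that the
computation `M` surely finishes and that its final state can be coupled, through the relation `R`,
with a random value of law `ρ`.
-/

/-! ### Euclidean norms and singular values -/

theorem l2norm_sq {d : ℕ} (v : Fin d → ℂ) : l2norm v ^ 2 = ∑ i, ‖v i‖ ^ 2 :=
  Real.sq_sqrt (Finset.sum_nonneg fun _ _ => by positivity)

theorem l2norm_nonneg {d : ℕ} (v : Fin d → ℂ) : 0 ≤ l2norm v := Real.sqrt_nonneg _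

theorem l2norm_eq_norm {d : ℕ} (v : Fin d → ℂ) : l2norm v = ‖WithLp.toLp 2 v‖ := by
  rw [l2norm, EuclideanSpace.norm_eq]

theorem l2norm_eq_zero {d : ℕ} {v : Fin d → ℂ} : l2norm v = 0 ↔ v = 0 := by
  rw [l2norm_eq_norm, norm_eq_zero, WithLp.toLp_eq_zero]

theorem frobNorm_sq {m n : ℕ} (A : Matrix (Fin m) (Fin n) ℂ) :
    frobNorm A ^ 2 = ∑ i, ∑ j, ‖A i j‖ ^ 2 :=
  Real.sq_sqrt (Finset.sum_nonneg fun _ _ => Finset.sum_nonneg fun _ _ => by positivity)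

theorem frobNorm_nonneg {m n : ℕ} (A : Matrix (Fin m) (Fin n) ℂ) : 0 ≤ frobNorm A :=
  Real.sqrt_nonneg _

theorem frobNorm_pos {m n : ℕ} {A : Matrix (Fin m) (Fin n) ℂ} (hA : A ≠ 0) : 0 < frobNorm A := by
  refine (frobNorm_nonneg A).lt_of_ne' fun h => hA ?_
  have h2 : ∑ i, ∑ j, ‖A i j‖ ^ 2 = 0 := by rw [← frobNorm_sq, h]; simp
  ext i j
  rw [Finset.sum_eq_zero_iff_of_nonneg
    (fun _ _ => Finset.sum_nonneg fun _ _ => by positivity)] at h2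
  have h3 := h2 i (Finset.mem_univ _)
  rw [Finset.sum_eq_zero_iff_of_nonneg (fun _ _ => by positivity)] at h3
  simpa using h3 j (Finset.mem_univ _)

open LinearMap Module InnerProductSpace in
/-- Rayleigh expansion of `‖T x‖²` in the right singular vectors. -/
theorem norm_sq_eq_sum_singularValues {E F : Type*}
    [NormedAddCommGroup E] [InnerProductSpace ℂ E] [FiniteDimensional ℂ E]
    [NormedAddCommGroup F] [InnerProductSpace ℂ F] [FiniteDimensional ℂ F]
    (T : E →ₗ[ℂ] F) (x : E) :
    ‖T x‖ ^ 2 = ∑ i : Fin (finrank ℂ E), T.singularValues i ^ 2 *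
      ‖inner ℂ (T.isSymmetric_adjoint_comp_self.eigenvectorBasis rfl i) x‖ ^ 2 := by
  have hS := T.isSymmetric_adjoint_comp_self
  set v := hS.eigenvectorBasis rfl with hv
  have h1 : ((‖T x‖ ^ 2 : ℝ) : ℂ) = inner ℂ x ((T.adjoint ∘ₗ T) x) := by
    rw [LinearMap.comp_apply, LinearMap.adjoint_inner_right, inner_self_eq_norm_sq_to_K]
    simp
  have h2 : inner ℂ x ((T.adjoint ∘ₗ T) x) =
      ((∑ i : Fin (finrank ℂ E), T.singularValues i ^ 2 * ‖inner ℂ (v i) x‖ ^ 2 : ℝ) : ℂ) := by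
    rw [← v.sum_inner_mul_inner, Complex.ofReal_sum]
    refine Finset.sum_congr rfl fun i _ => ?_
    have h3 : inner ℂ (v i) ((T.adjoint ∘ₗ T) x)
        = (T.singularValues i ^ 2 : ℝ) * inner ℂ (v i) x := by
      rw [← hS, hv, hS.apply_eigenvectorBasis rfl i, inner_smul_left, T.sq_singularValues_fin rfl]
      simp
    rw [h3, ← inner_conj_symm x (v i)]
    have h4 := Complex.conj_mul' (inner ℂ (v i) x)
    push_cast
    linear_combination ((T.singularValues i : ℂ) ^ 2) * h4
  exact_mod_cast h1.trans h2

open LinearMap Module InnerProductSpace in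
/-- On the row space, `A` shrinks lengths by at most the factor `σ_min`. -/
theorem singularValues_mul_norm_adjoint_le {E F : Type*}
    [NormedAddCommGroup E] [InnerProductSpace ℂ E] [FiniteDimensional ℂ E]
    [NormedAddCommGroup F] [InnerProductSpace ℂ F] [FiniteDimensional ℂ F]
    (T : E →ₗ[ℂ] F) (w : F) :
    T.singularValues (finrank ℂ T.range - 1) ^ 2 * ‖T.adjoint w‖ ^ 2 ≤ ‖T (T.adjoint w)‖ ^ 2 := by
  set v := T.isSymmetric_adjoint_comp_self.eigenvectorBasis rfl with hv
  rw [norm_sq_eq_sum_singularValues T, ← v.sum_sq_norm_inner_right, Finset.mul_sum]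
  refine Finset.sum_le_sum fun i _ => ?_
  rcases (T.singularValues_nonneg i).eq_or_lt' with h | h
  · have h1 : ‖T (v i)‖ ^ 2 = 0 := by
      rw [norm_sq_eq_sum_singularValues]
      refine Finset.sum_eq_zero fun j _ => ?_
      rcases eq_or_ne j i with rfl | hj
      · simp [h]
      · rw [v.inner_eq_zero hj]; simp
    have h2 : inner ℂ (v i) (T.adjoint w) = 0 := by
      rw [LinearMap.adjoint_inner_right]
      have : T (v i) = 0 := by simpa using h1
      simp [this]
    simp [h, h2]
  · rw [T.singularValues_pos_iff_lt_finrank_range] at h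
    gcongr
    · exact T.singularValues_nonneg _
    · exact T.singularValues_antitone (by omega)

open LinearMap Module InnerProductSpace in
/-- The squared Frobenius norm is the sum of the squared singular values, so at most
`rank · ‖T‖²`. -/
theorem sum_norm_sq_orthonormalBasis_le {ι E F : Type*} [Fintype ι]
    [NormedAddCommGroup E] [InnerProductSpace ℂ E] [FiniteDimensional ℂ E]
    [NormedAddCommGroup F] [InnerProductSpace ℂ F] [FiniteDimensional ℂ F]
    (T : E →ₗ[ℂ] F) (e : OrthonormalBasis ι ℂ E) :
    ∑ j, ‖T (e j)‖ ^ 2 ≤ finrank ℂ T.range * ‖T.toContinuousLinearMap‖ ^ 2 := by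
  set v := T.isSymmetric_adjoint_comp_self.eigenvectorBasis rfl with hv
  have h1 : ∑ j, ‖T (e j)‖ ^ 2 = ∑ i : Fin (finrank ℂ E), T.singularValues i ^ 2 := by
    simp_rw [norm_sq_eq_sum_singularValues T (e _)]
    rw [Finset.sum_comm]
    refine Finset.sum_congr rfl fun i _ => ?_
    rw [← Finset.mul_sum, e.sum_sq_norm_inner_left]
    simp
  have h2 (i : Fin (finrank ℂ E)) : T.singularValues i ^ 2 = ‖T (v i)‖ ^ 2 := by
    rw [norm_sq_eq_sum_singularValues, Finset.sum_eq_single i]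
    · rw [inner_self_eq_norm_sq_to_K]; simp
    · intro j _ hj
      rw [v.inner_eq_zero hj]; simp
    · simp
  have h3 (i : Fin (finrank ℂ E)) : T.singularValues i ^ 2 ≤ ‖T.toContinuousLinearMap‖ ^ 2 := by
    rw [h2]
    have := T.toContinuousLinearMap.le_opNorm (v i)
    gcongr
    simpa using this
  rw [h1, ← Finset.sum_filter_add_sum_filter_not _
    (fun i : Fin (finrank ℂ E) => (i : ℕ) < finrank ℂ T.range)]
  rw [Finset.sum_eq_zero (s := Finset.filter
    (fun i : Fin (finrank ℂ E) => ¬ (i : ℕ) < finrank ℂ T.range) _), add_zero]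
  · refine (Finset.sum_le_card_nsmul _ _ _ fun i _ => h3 i).trans ?_
    rw [nsmul_eq_mul]
    gcongr
    have := Finset.card_le_card_of_injOn (s := Finset.univ.filter
      (fun i : Fin (finrank ℂ E) => (i : ℕ) < finrank ℂ T.range))
      (t := Finset.range (finrank ℂ T.range)) Fin.val (by intro i hi; simpa using hi)
      (Fin.val_injective.injOn)
    simpa using this
  · intro i hi
    have : ¬ (i : ℕ) < finrank ℂ T.range := by simpa using hi
    rw [T.singularValues_eq_zero_iff_le_finrank_range.2 (not_lt.1 this)]
    simp

theorem finrank_range_toEuclideanLin {m n : ℕ} (A : Matrix (Fin m) (Fin n) ℂ) :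
    Module.finrank ℂ (Matrix.toEuclideanLin A).range = A.rank :=
  (Matrix.rank_eq_finrank_range_toLin A (EuclideanSpace.basisFun _ ℂ).toBasis
    (EuclideanSpace.basisFun _ ℂ).toBasis).symm

/-- The spectral input of the analysis: since `‖A‖_F² ≤ rank(A) ‖A‖² = rank(A) κ² σ_min²`, every
vector `v` of the row space satisfies `‖A‖_F² ‖v‖² ≤ rank(A) κ² ‖A v‖²`. -/
theorem frobNorm_sq_mul_le {m n : ℕ} (A : Matrix (Fin m) (Fin n) ℂ) (w : Fin m → ℂ) :
    frobNorm A ^ 2 * l2norm (Aᴴ *ᵥ w) ^ 2 ≤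
      A.rank * condNumber A ^ 2 * l2norm (A *ᵥ (Aᴴ *ᵥ w)) ^ 2 := by
  set T := Matrix.toEuclideanLin A with hT
  have hr := finrank_range_toEuclideanLin A
  have h1 := singularValues_mul_norm_adjoint_le T (WithLp.toLp 2 w)
  have h2 := sum_norm_sq_orthonormalBasis_le T (EuclideanSpace.basisFun (Fin n) ℂ)
  have h3 : ∑ j, ‖T (EuclideanSpace.basisFun (Fin n) ℂ j)‖ ^ 2 = frobNorm A ^ 2 := by
    rw [frobNorm_sq, Finset.sum_comm]
    refine Finset.sum_congr rfl fun j _ => ?_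
    rw [EuclideanSpace.norm_sq_eq]
    refine Finset.sum_congr rfl fun i _ => ?_
    simp [hT]
  have h4 : T.adjoint (WithLp.toLp 2 w) = WithLp.toLp 2 (Aᴴ *ᵥ w) := by
    rw [hT, ← Matrix.toEuclideanLin_conjTranspose_eq_adjoint]
    rfl
  have h5 : T (WithLp.toLp 2 (Aᴴ *ᵥ w)) = WithLp.toLp 2 (A *ᵥ (Aᴴ *ᵥ w)) := rfl
  rw [h4, h5, ← l2norm_eq_norm, ← l2norm_eq_norm, hr] at h1
  rw [h3, hr] at h2
  rcases Nat.eq_zero_or_pos A.rank with h0 | hpos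
  · have : frobNorm A ^ 2 = 0 := le_antisymm (by simpa [h0] using h2) (by positivity)
    simp [this, h0]
  have hσ : 0 < sigmaMin A := by
    rw [sigmaMin, LinearMap.singularValues_pos_iff_lt_finrank_range, hr]; omega
  change sigmaMin A ^ 2 * _ ≤ _ at h1
  change _ ≤ (A.rank : ℝ) * specNorm A ^ 2 at h2
  have h6 : specNorm A = condNumber A * sigmaMin A := by
    rw [condNumber]; field_simp
  calc frobNorm A ^ 2 * l2norm (Aᴴ *ᵥ w) ^ 2
      ≤ (A.rank * specNorm A ^ 2) * l2norm (Aᴴ *ᵥ w) ^ 2 := by gcongr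
    _ = A.rank * condNumber A ^ 2 * (sigmaMin A ^ 2 * l2norm (Aᴴ *ᵥ w) ^ 2) := by rw [h6]; ring
    _ ≤ _ := by gcongr

/-! ### Expansions of Euclidean norms -/

theorem l2norm_sq_eq_dotProduct {d : ℕ} (v : Fin d → ℂ) :
    ((l2norm v ^ 2 : ℝ) : ℂ) = star v ⬝ᵥ v := by
  rw [l2norm_sq, dotProduct]
  push_cast
  exact Finset.sum_congr rfl fun i _ => (Complex.conj_mul' _).symm

theorem l2norm_add_sq {d : ℕ} (v w : Fin d → ℂ) :
    l2norm (v + w) ^ 2 = l2norm v ^ 2 + 2 * (star v ⬝ᵥ w).re + l2norm w ^ 2 := by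
  simp only [l2norm_sq, dotProduct, Complex.re_sum, Finset.mul_sum, ← Finset.sum_add_distrib]
  refine Finset.sum_congr rfl fun i _ => ?_
  simp only [← Complex.normSq_eq_norm_sq, Complex.normSq_apply, Pi.add_apply, Pi.star_apply,
    Complex.add_re, Complex.add_im, Complex.mul_re, RCLike.star_def, Complex.conj_re,
    Complex.conj_im]
  ring

theorem l2norm_smul_sq {d : ℕ} (z : ℂ) (v : Fin d → ℂ) :
    l2norm (z • v) ^ 2 = ‖z‖ ^ 2 * l2norm v ^ 2 := by
  simp [l2norm_sq, mul_pow, Finset.mul_sum]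

theorem l2norm_star {d : ℕ} (v : Fin d → ℂ) : l2norm (star v) = l2norm v := by
  simp [l2norm]

theorem l2norm_sq_add_le {d : ℕ} (v w : Fin d → ℂ) :
    l2norm (v + w) ^ 2 ≤ 2 * l2norm v ^ 2 + 2 * l2norm w ^ 2 := by
  simp only [l2norm_sq, Finset.mul_sum, ← Finset.sum_add_distrib]
  refine Finset.sum_le_sum fun i _ => ?_
  have := norm_add_le (v i) (w i)
  simp only [Pi.add_apply]
  nlinarith [norm_nonneg (v i + w i), norm_nonneg (v i), norm_nonneg (w i),
    sq_nonneg (‖v i‖ - ‖w i‖)]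

theorem re_dotProduct_le {d : ℕ} (v w : Fin d → ℂ) :
    (star v ⬝ᵥ w).re ≤ l2norm v * l2norm w := by
  have h : star v ⬝ᵥ w = inner ℂ (WithLp.toLp 2 v) (WithLp.toLp 2 w) := by
    rw [EuclideanSpace.inner_eq_star_dotProduct, dotProduct_comm]
  rw [h, l2norm_eq_norm, l2norm_eq_norm]
  exact re_inner_le_norm (𝕜 := ℂ) _ _

theorem l2norm_mulVec_sq {m n : ℕ} (A : Matrix (Fin m) (Fin n) ℂ) (v : Fin n → ℂ) :
    ((l2norm (A *ᵥ v) ^ 2 : ℝ) : ℂ) = star v ⬝ᵥ (Aᴴ *ᵥ (A *ᵥ v)) := by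
  rw [l2norm_sq_eq_dotProduct, Matrix.star_mulVec, Matrix.dotProduct_mulVec,
    Matrix.dotProduct_mulVec, Matrix.dotProduct_mulVec]

theorem frobNorm_sq_eq_sum_row {m n : ℕ} (A : Matrix (Fin m) (Fin n) ℂ) :
    frobNorm A ^ 2 = ∑ r, l2norm (A r) ^ 2 := by
  rw [frobNorm_sq]
  exact Finset.sum_congr rfl fun r _ => (l2norm_sq _).symm

theorem l2norm_mulVec_le {m n : ℕ} (A : Matrix (Fin m) (Fin n) ℂ) (v : Fin n → ℂ) :
    l2norm (A *ᵥ v) ^ 2 ≤ frobNorm A ^ 2 * l2norm v ^ 2 := by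
  rw [l2norm_sq (A *ᵥ v), frobNorm_sq_eq_sum_row, Finset.sum_mul]
  refine Finset.sum_le_sum fun r _ => ?_
  have h : (A *ᵥ v) r = inner ℂ (WithLp.toLp 2 (star (A r))) (WithLp.toLp 2 v) := by
    rw [EuclideanSpace.inner_eq_star_dotProduct, dotProduct_comm]
    simp [Matrix.mulVec]
  rw [h, ← mul_pow]
  have := norm_inner_le_norm (𝕜 := ℂ) (WithLp.toLp 2 (star (A r))) (WithLp.toLp 2 v)
  rw [← l2norm_eq_norm, ← l2norm_eq_norm, l2norm_star] at this
  gcongr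

/-! ### The least-squares solution -/

section LeastSquares
variable {m n : ℕ} (A : Matrix (Fin m) (Fin n) ℂ) (b : Fin m → ℂ)

theorem pinv_mulVec_mem_rowSpace : ∃ w, pinv A *ᵥ b = Aᴴ *ᵥ w := by
  obtain ⟨-, h2, -, h4⟩ := pinv_penrose A
  refine ⟨(pinv A)ᴴ *ᵥ (pinv A *ᵥ b), ?_⟩
  rw [Matrix.mulVec_mulVec, Matrix.mulVec_mulVec, ← Matrix.conjTranspose_mul, h4, h2]

theorem normal_equation : Aᴴ *ᵥ (A *ᵥ (pinv A *ᵥ b)) = Aᴴ *ᵥ b := by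
  obtain ⟨h1, -, h3, -⟩ := pinv_penrose A
  rw [Matrix.mulVec_mulVec, Matrix.mulVec_mulVec]
  congr 1
  rw [Matrix.mul_assoc, ← h3, ← Matrix.conjTranspose_mul, h1]

theorem l2norm_mulVec_pinv_le : l2norm (A *ᵥ (pinv A *ᵥ b)) ≤ l2norm b := by
  have h : ((l2norm (A *ᵥ (pinv A *ᵥ b)) ^ 2 : ℝ) : ℂ) = star (A *ᵥ (pinv A *ᵥ b)) ⬝ᵥ b := by
    rw [l2norm_mulVec_sq, normal_equation, Matrix.star_mulVec A, Matrix.dotProduct_mulVec]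
  have h2 := re_dotProduct_le (A *ᵥ (pinv A *ᵥ b)) b
  rw [← h, Complex.ofReal_re] at h2
  by_contra! hlt
  nlinarith [l2norm_nonneg b, l2norm_nonneg (A *ᵥ (pinv A *ᵥ b))]

end LeastSquares

/-! ### Stochastic gradient descent with sampled rows and columns -/

noncomputable section SGD
variable {m n : ℕ} (A : Matrix (Fin m) (Fin n) ℂ) (b : Fin m → ℂ) (c : ℝ)

/-- Probability of drawing a row by its squared norm and then a column by squared modulus. -/
def pairProb (ω : Fin m × Fin n) : ℝ := ‖A ω.1 ω.2‖ ^ 2 / frobNorm A ^ 2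

/-- The multiple of the sampled row that is added to the iterate `x`. -/
def stepCoef (x : Fin n → ℂ) (ω : Fin m × Fin n) : ℂ :=
  c * (b ω.1 / (l2norm (A ω.1) ^ 2 : ℝ) - x ω.2 / star (A ω.1 ω.2))

/-- The iterate of stochastic gradient descent, started at `0`, after the samples in the list, whose
head is the most recent sample. -/
def iter : List (Fin m × Fin n) → Fin n → ℂ
  | [] => 0
  | ω :: l => iter l + stepCoef A b c (iter l) ω • star (A ω.1)

/-- The sum of the squared lengths of the steps. -/
def stepMass : List (Fin m × Fin n) → ℝ
  | [] => 0
  | ω :: l => stepMass l + ‖stepCoef A b c (iter A b c l) ω‖ ^ 2 * l2norm (A ω.1) ^ 2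

/-- `profile A l j` is the sum of the probabilities of `j` under the distributions `𝒟` of the rows
drawn in `l`. -/
def profile : List (Fin m × Fin n) → Fin n → ℝ
  | [], _ => 0
  | ω :: l, j => profile l j + sqDist (A ω.1) j

/-- Expectation of `f` after `t` further samples, the list `l` being drawn already. -/
def tapeExp : ℕ → (List (Fin m × Fin n) → ℝ) → List (Fin m × Fin n) → ℝ
  | 0, f, l => f l
  | t + 1, f, l => ∑ ω, pairProb A ω * tapeExp t f (ω :: l)

theorem pairProb_nonneg (ω : Fin m × Fin n) : 0 ≤ pairProb A ω := by
  unfold pairProb; positivity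

variable {A} in
theorem sum_pairProb (hA : A ≠ 0) : ∑ ω, pairProb A ω = 1 := by
  have h : ∑ ω : Fin m × Fin n, ‖A ω.1 ω.2‖ ^ 2 = frobNorm A ^ 2 := by
    rw [frobNorm_sq, Fintype.sum_prod_type]
  unfold pairProb
  rw [← Finset.sum_div, h]
  exact div_self (pow_pos (frobNorm_pos hA) 2).ne'

variable {A} in
theorem sum_pairProb_mul_const (hA : A ≠ 0) (a : ℝ) : ∑ ω, pairProb A ω * a = a := by
  rw [← Finset.sum_mul, sum_pairProb hA, one_mul]

theorem tapeExp_mono {f g : List (Fin m × Fin n) → ℝ} {t : ℕ} {l : List (Fin m × Fin n)}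
    (h : ∀ l', l'.length = l.length + t → f l' ≤ g l') : tapeExp A t f l ≤ tapeExp A t g l := by
  induction t generalizing l with
  | zero => exact h l (by simp)
  | succ t ih =>
    exact Finset.sum_le_sum fun ω _ => mul_le_mul_of_nonneg_left
      (ih fun l' hl => h l' (by simp at hl; omega)) (pairProb_nonneg A ω)

theorem tapeExp_add (f g : List (Fin m × Fin n) → ℝ) (t : ℕ) (l : List (Fin m × Fin n)) :
    tapeExp A t (fun l => f l + g l) l = tapeExp A t f l + tapeExp A t g l := by
  induction t generalizing l with
  | zero => rfl
  | succ t ih => simp only [tapeExp, ih, mul_add, Finset.sum_add_distrib]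

theorem tapeExp_const_mul (a : ℝ) (f : List (Fin m × Fin n) → ℝ) (t : ℕ)
    (l : List (Fin m × Fin n)) :
    tapeExp A t (fun l => a * f l) l = a * tapeExp A t f l := by
  induction t generalizing l with
  | zero => rfl
  | succ t ih =>
    simp only [tapeExp, ih, Finset.mul_sum]
    exact Finset.sum_congr rfl fun ω _ => by ring

theorem tapeExp_sum {ι : Type*} (s : Finset ι) (f : ι → List (Fin m × Fin n) → ℝ) (t : ℕ)
    (l : List (Fin m × Fin n)) :
    tapeExp A t (fun l => ∑ i ∈ s, f i l) l = ∑ i ∈ s, tapeExp A t (f i) l := by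
  induction t generalizing l with
  | zero => rfl
  | succ t ih =>
    simp only [tapeExp, ih, Finset.mul_sum]
    exact Finset.sum_comm

variable {A} in
theorem tapeExp_const (hA : A ≠ 0) (a : ℝ) (t : ℕ) (l : List (Fin m × Fin n)) :
    tapeExp A t (fun _ => a) l = a := by
  induction t generalizing l with
  | zero => rfl
  | succ t ih => simp only [tapeExp, ih, ← Finset.sum_mul, sum_pairProb hA, one_mul]

theorem profile_nonneg (l : List (Fin m × Fin n)) (j : Fin n) : 0 ≤ profile A l j := by
  induction l with
  | nil => simp [profile]
  | cons ω l ih => unfold profile sqDist; positivity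

theorem stepMass_nonneg (l : List (Fin m × Fin n)) : 0 ≤ stepMass A b c l := by
  induction l with
  | nil => simp [stepMass]
  | cons ω l ih => unfold stepMass; positivity

/-- Cauchy-Schwarz for the expansion of the iterate in the sampled rows. -/
theorem norm_iter_sq_le (l : List (Fin m × Fin n)) (j : Fin n) :
    ‖iter A b c l j‖ ^ 2 ≤ stepMass A b c l * profile A l j := by
  induction l with
  | nil => simp [iter, stepMass]
  | cons ω l ih =>
    simp only [iter, stepMass, profile, Pi.add_apply, Pi.smul_apply, Pi.star_apply, smul_eq_mul]
    set x := ‖iter A b c l j‖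
    set y := stepCoef A b c (iter A b c l) ω
    set M := stepMass A b c l
    set S := profile A l j
    have hM : 0 ≤ M := stepMass_nonneg A b c l
    have hS : 0 ≤ S := profile_nonneg A l j
    have hx : 0 ≤ x := norm_nonneg _
    set p := ‖y‖ * l2norm (A ω.1) with hp
    set q := ‖A ω.1 j‖ / l2norm (A ω.1) with hq
    have hp0 : 0 ≤ p := mul_nonneg (norm_nonneg _) (l2norm_nonneg _)
    have hq0 : 0 ≤ q := div_nonneg (norm_nonneg _) (l2norm_nonneg _)
    have h1 : ‖y * star (A ω.1 j)‖ = p * q := by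
      rw [norm_mul, norm_star, hp, hq]
      rcases eq_or_ne (l2norm (A ω.1)) 0 with h | h
      · rw [l2norm_eq_zero] at h
        simp [h]
      · field_simp
    have h2 : ‖iter A b c l j + y * star (A ω.1 j)‖ ≤ x + p * q := by
      rw [← h1]; exact norm_add_le _ _
    have h3 : 2 * x * (p * q) ≤ M * q ^ 2 + S * p ^ 2 := by
      refine abs_le_of_sq_le_sq' ?_ (by positivity) |>.2
      calc (2 * x * (p * q)) ^ 2 = 4 * x ^ 2 * (p ^ 2 * q ^ 2) := by ring
        _ ≤ 4 * (M * S) * (p ^ 2 * q ^ 2) := by gcongr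
        _ ≤ (M * q ^ 2 + S * p ^ 2) ^ 2 := by nlinarith [sq_nonneg (M * q ^ 2 - S * p ^ 2)]
    calc ‖iter A b c l j + y * star (A ω.1 j)‖ ^ 2 ≤ (x + p * q) ^ 2 := by gcongr
      _ ≤ (M + p ^ 2) * (S + q ^ 2) := by nlinarith
      _ = _ := by rw [hp, hq, sqDist, mul_pow, div_pow]

/-- The iterate stays in the row space, where `A` is bounded below. -/
theorem iter_mem_rowSpace (l : List (Fin m × Fin n)) : ∃ w, iter A b c l = Aᴴ *ᵥ w := by
  induction l with
  | nil => exact ⟨0, by simp [iter]⟩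
  | cons ω l ih =>
    obtain ⟨w, hw⟩ := ih
    refine ⟨w + Pi.single ω.1 (stepCoef A b c (iter A b c l) ω), ?_⟩
    rw [Matrix.mulVec_add, ← hw, iter]
    congr 1
    ext i
    simp [Matrix.conjTranspose_apply, mul_comm]

variable {A} in
/-- Second moment of a step. -/
theorem sum_pairProb_mul_stepCoef_sq_le (hA : A ≠ 0) (x : Fin n → ℂ) :
    ∑ ω, pairProb A ω * (‖stepCoef A b c x ω‖ ^ 2 * l2norm (A ω.1) ^ 2) ≤
      2 * c ^ 2 * (l2norm x ^ 2 + l2norm b ^ 2 / frobNorm A ^ 2) := by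
  have hF := frobNorm_pos hA
  have key (ω : Fin m × Fin n) :
      pairProb A ω * (‖stepCoef A b c x ω‖ ^ 2 * l2norm (A ω.1) ^ 2) ≤
        2 * c ^ 2 / frobNorm A ^ 2 * (‖A ω.1 ω.2‖ ^ 2 / l2norm (A ω.1) ^ 2 * ‖b ω.1‖ ^ 2
          + l2norm (A ω.1) ^ 2 * ‖x ω.2‖ ^ 2) := by
    rcases eq_or_ne (A ω.1 ω.2) 0 with ha | ha
    · rw [pairProb, ha]
      have : 0 ≤ l2norm (A ω.1) ^ 2 * ‖x ω.2‖ ^ 2 := by positivity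
      simp only [norm_zero, ne_eq, OfNat.ofNat_ne_zero, not_false_eq_true, zero_pow, zero_div,
        zero_mul, zero_add]
      positivity
    · have hr : 0 < l2norm (A ω.1) := by
        refine (l2norm_nonneg _).lt_of_ne' fun h => ha ?_
        rw [l2norm_eq_zero] at h
        simp [h]
      have ha' : 0 < ‖A ω.1 ω.2‖ := norm_pos_iff.2 ha
      have h1 : ‖stepCoef A b c x ω‖ ^ 2 ≤ c ^ 2 * (2 * (‖b ω.1‖ / l2norm (A ω.1) ^ 2) ^ 2
          + 2 * (‖x ω.2‖ / ‖A ω.1 ω.2‖) ^ 2) := by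
        rw [stepCoef, norm_mul, mul_pow, Complex.norm_real, Real.norm_eq_abs, sq_abs]
        gcongr
        have h2 := norm_sub_le (b ω.1 / (l2norm (A ω.1) ^ 2 : ℝ)) (x ω.2 / star (A ω.1 ω.2))
        rw [norm_div, norm_div, norm_star, Complex.norm_real, Real.norm_eq_abs,
          abs_of_pos (by positivity)] at h2
        set p := ‖b ω.1‖ / l2norm (A ω.1) ^ 2
        set q := ‖x ω.2‖ / ‖A ω.1 ω.2‖
        calc _ ≤ (p + q) ^ 2 := by gcongr
          _ ≤ _ := by nlinarith [sq_nonneg (p - q)]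
      calc _ ≤ pairProb A ω * (c ^ 2 * (2 * (‖b ω.1‖ / l2norm (A ω.1) ^ 2) ^ 2
          + 2 * (‖x ω.2‖ / ‖A ω.1 ω.2‖) ^ 2) * l2norm (A ω.1) ^ 2) := by
            gcongr; exact pairProb_nonneg A ω
        _ = _ := by
          rw [pairProb]
          field_simp
  refine (Finset.sum_le_sum fun ω _ => key ω).trans ?_
  rw [← Finset.mul_sum, Fintype.sum_prod_type]
  have h2 (r : Fin m) : ∑ j, (‖A r j‖ ^ 2 / l2norm (A r) ^ 2 * ‖b r‖ ^ 2
      + l2norm (A r) ^ 2 * ‖x j‖ ^ 2) ≤ ‖b r‖ ^ 2 + l2norm (A r) ^ 2 * l2norm x ^ 2 := by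
    rw [Finset.sum_add_distrib, ← Finset.mul_sum, ← l2norm_sq, ← Finset.sum_mul, ← Finset.sum_div,
      ← l2norm_sq]
    gcongr
    exact mul_le_of_le_one_left (by positivity) (div_self_le_one _)
  calc _ ≤ 2 * c ^ 2 / frobNorm A ^ 2 * ∑ r, (‖b r‖ ^ 2 + l2norm (A r) ^ 2 * l2norm x ^ 2) := by
        gcongr with r
        exact h2 r
    _ = _ := by
      rw [Finset.sum_add_distrib, ← l2norm_sq, ← Finset.sum_mul, ← frobNorm_sq_eq_sum_row]
      field_simp
      ring

/-- The steps are unbiased estimators of the gradient step of size `c / ‖A‖_F²`. -/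
theorem sum_pairProb_mul_stepCoef (x : Fin n → ℂ) (i : Fin n) :
    ∑ ω, (pairProb A ω : ℂ) * (stepCoef A b c x ω * star (A ω.1 i)) =
      c / (frobNorm A ^ 2 : ℝ) * (Aᴴ *ᵥ (b - A *ᵥ x)) i := by
  rw [Fintype.sum_prod_type, Matrix.mulVec, dotProduct, Finset.mul_sum]
  refine Finset.sum_congr rfl fun r _ => ?_
  have h1 (j : Fin n) : (pairProb A (r, j) : ℂ) * (stepCoef A b c x (r, j) * star (A r i)) =
      c / (frobNorm A ^ 2 : ℝ) * star (A r i) *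
        (b r / (l2norm (A r) ^ 2 : ℝ) * (‖A r j‖ ^ 2 : ℝ) - A r j * x j) := by
    have h2 : ((‖A r j‖ ^ 2 : ℝ) : ℂ) * (x j / star (A r j)) = A r j * x j := by
      rcases eq_or_ne (A r j) 0 with h | h
      · simp [h]
      · have h3 : ((‖A r j‖ ^ 2 : ℝ) : ℂ) = A r j * star (A r j) := by
          push_cast
          exact (Complex.mul_conj' _).symm
        have h4 : star (A r j) ≠ 0 := star_ne_zero.2 h
        rw [h3]
        field_simp
    rw [← h2, pairProb, stepCoef, Complex.ofReal_div]
    ring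
  simp_rw [h1]
  rw [← Finset.mul_sum, Finset.sum_sub_distrib, ← Finset.mul_sum, ← Complex.ofReal_sum,
    ← l2norm_sq]
  rcases eq_or_ne (l2norm (A r)) 0 with h | h
  · rw [l2norm_eq_zero] at h
    simp [h, Matrix.conjTranspose_apply]
  · have h' : ((l2norm (A r) ^ 2 : ℝ) : ℂ) ≠ 0 := by exact_mod_cast pow_ne_zero 2 h
    rw [div_mul_cancel₀ _ h']
    simp only [Matrix.conjTranspose_apply, Pi.sub_apply, Matrix.mulVec, dotProduct]
    ring

end SGD

/-! ### Convergence of gradient descent and the expected output weights -/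

section Convergence
variable {m n : ℕ} {A : Matrix (Fin m) (Fin n) ℂ} {b : Fin m → ℂ} {c : ℝ}

/-- One step contracts the expected squared error, up to the noise of the step. The contraction
uses that the error stays in the row space of `A`. -/
theorem sum_pairProb_mul_error_le (hA : A ≠ 0) {K θ : ℝ}
    (hK : ∀ w, frobNorm A ^ 2 * l2norm (Aᴴ *ᵥ w) ^ 2 ≤ K * l2norm (A *ᵥ (Aᴴ *ᵥ w)) ^ 2)
    (hK0 : 0 < K) (hθ : 1 ≤ θ)
    (hb : l2norm b ^ 2 ≤ θ * frobNorm A ^ 2 * l2norm (pinv A *ᵥ b) ^ 2)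
    (hc : 0 < c) (hcK : 4 * c * K ≤ 1) (l : List (Fin m × Fin n)) :
    ∑ ω, pairProb A ω * l2norm (iter A b c (ω :: l) - pinv A *ᵥ b) ^ 2 ≤
        (1 - c / K) * l2norm (iter A b c l - pinv A *ᵥ b) ^ 2
          + 6 * θ * c ^ 2 * l2norm (pinv A *ᵥ b) ^ 2 ∧
      ∑ ω, pairProb A ω * stepMass A b c (ω :: l) ≤
        stepMass A b c l + 4 * c ^ 2 * l2norm (iter A b c l - pinv A *ᵥ b) ^ 2
          + 6 * θ * c ^ 2 * l2norm (pinv A *ᵥ b) ^ 2 := by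
  set xs := pinv A *ᵥ b with hxs
  set x := iter A b c l with hx
  have hF := frobNorm_pos hA
  have h1 := sum_pairProb_mul_stepCoef_sq_le b c hA x
  have h2 : l2norm x ^ 2 ≤ 2 * l2norm (x - xs) ^ 2 + 2 * l2norm xs ^ 2 := by
    simpa using l2norm_sq_add_le (x - xs) xs
  have h3 : l2norm b ^ 2 / frobNorm A ^ 2 ≤ θ * l2norm xs ^ 2 := by
    rw [div_le_iff₀ (by positivity)]
    linarith
  have h4 : 2 * c ^ 2 * (l2norm x ^ 2 + l2norm b ^ 2 / frobNorm A ^ 2) ≤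
      4 * c ^ 2 * l2norm (x - xs) ^ 2 + 6 * θ * c ^ 2 * l2norm xs ^ 2 := by
    have h5 : l2norm xs ^ 2 ≤ θ * l2norm xs ^ 2 := le_mul_of_one_le_left (by positivity) hθ
    calc _ ≤ 2 * c ^ 2 * (2 * l2norm (x - xs) ^ 2 + 2 * (θ * l2norm xs ^ 2)
          + θ * l2norm xs ^ 2) := by gcongr; linarith
      _ = _ := by ring
  constructor
  · obtain ⟨w, hw⟩ : ∃ w, x - xs = Aᴴ *ᵥ w := by
      obtain ⟨w1, hw1⟩ := iter_mem_rowSpace A b c l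
      obtain ⟨w2, hw2⟩ := pinv_mulVec_mem_rowSpace A b
      exact ⟨w1 - w2, by rw [Matrix.mulVec_sub, ← hw1, ← hw2]⟩
    have hgap : c / K * l2norm (x - xs) ^ 2 ≤ c / frobNorm A ^ 2 * l2norm (A *ᵥ (x - xs)) ^ 2 := by
      have := hK w
      rw [← hw] at this
      rw [div_mul_eq_mul_div, div_mul_eq_mul_div, div_le_div_iff₀ hK0 (by positivity)]
      nlinarith
    have hgrad : Aᴴ *ᵥ (b - A *ᵥ x) = -(Aᴴ *ᵥ (A *ᵥ (x - xs))) := by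
      rw [Matrix.mulVec_sub, Matrix.mulVec_sub, Matrix.mulVec_sub, hxs, normal_equation]
      simp
    have hcross : ∑ ω, pairProb A ω *
        (star (x - xs) ⬝ᵥ (stepCoef A b c x ω • star (A ω.1))).re =
          -(c / frobNorm A ^ 2 * l2norm (A *ᵥ (x - xs)) ^ 2) := by
      have h6 : ∑ ω, (pairProb A ω : ℂ) *
          (star (x - xs) ⬝ᵥ (stepCoef A b c x ω • star (A ω.1))) =
            ((-(c / frobNorm A ^ 2 * l2norm (A *ᵥ (x - xs)) ^ 2) : ℝ) : ℂ) := by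
        simp only [dotProduct, Finset.mul_sum]
        rw [Finset.sum_comm]
        rw [Complex.ofReal_neg, Complex.ofReal_mul, l2norm_mulVec_sq, dotProduct, Finset.mul_sum,
          ← Finset.sum_neg_distrib]
        refine Finset.sum_congr rfl fun i _ => ?_
        have h7 := sum_pairProb_mul_stepCoef A b c x i
        rw [hgrad] at h7
        calc _ = star (x - xs) i * ∑ ω, (pairProb A ω : ℂ) *
              (stepCoef A b c x ω * star (A ω.1 i)) := by
              rw [Finset.mul_sum]
              refine Finset.sum_congr rfl fun ω _ => ?_
              simp only [Pi.smul_apply, Pi.star_apply, smul_eq_mul]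
              ring
          _ = _ := by
              rw [h7, Complex.ofReal_div]
              simp only [Pi.neg_apply]
              ring
      have := congrArg Complex.re h6
      rw [Complex.ofReal_re, Complex.re_sum] at this
      simpa only [Complex.re_ofReal_mul] using this
    have hexp : ∑ ω, pairProb A ω * l2norm (iter A b c (ω :: l) - xs) ^ 2 =
        l2norm (x - xs) ^ 2 + 2 * -(c / frobNorm A ^ 2 * l2norm (A *ᵥ (x - xs)) ^ 2)
          + ∑ ω, pairProb A ω * (‖stepCoef A b c x ω‖ ^ 2 * l2norm (A ω.1) ^ 2) := by
      rw [← hcross]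
      conv_rhs => rw [← sum_pairProb_mul_const hA (l2norm (x - xs) ^ 2)]
      rw [Finset.mul_sum, ← Finset.sum_add_distrib, ← Finset.sum_add_distrib]
      refine Finset.sum_congr rfl fun ω _ => ?_
      have h8 : iter A b c (ω :: l) - xs = (x - xs) + stepCoef A b c x ω • star (A ω.1) := by
        rw [iter]; abel
      rw [h8, l2norm_add_sq, l2norm_smul_sq, l2norm_star]
      ring
    have hcc : 4 * c ^ 2 * l2norm (x - xs) ^ 2 ≤ c / K * l2norm (x - xs) ^ 2 := by
      gcongr
      rw [le_div_iff₀ hK0]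
      nlinarith
    rw [hexp]
    linarith
  · have : ∑ ω, pairProb A ω * stepMass A b c (ω :: l) = stepMass A b c l +
        ∑ ω, pairProb A ω * (‖stepCoef A b c x ω‖ ^ 2 * l2norm (A ω.1) ^ 2) := by
      simp only [stepMass, mul_add, Finset.sum_add_distrib, ← Finset.sum_mul, sum_pairProb hA,
        one_mul, hx]
    rw [this]
    linarith

/-- The error decays geometrically to the noise level `6 θ c K ‖x⋆‖²`. -/
theorem tapeExp_error_le (hA : A ≠ 0) {K θ : ℝ}
    (hK : ∀ w, frobNorm A ^ 2 * l2norm (Aᴴ *ᵥ w) ^ 2 ≤ K * l2norm (A *ᵥ (Aᴴ *ᵥ w)) ^ 2)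
    (hK1 : 1 ≤ K) (hθ : 1 ≤ θ)
    (hb : l2norm b ^ 2 ≤ θ * frobNorm A ^ 2 * l2norm (pinv A *ᵥ b) ^ 2)
    (hc : 0 < c) (hcK : 4 * c * K ≤ 1) (t : ℕ) (l : List (Fin m × Fin n)) :
    tapeExp A t (fun l => l2norm (iter A b c l - pinv A *ᵥ b) ^ 2) l ≤
      (1 - c / K) ^ t * (l2norm (iter A b c l - pinv A *ᵥ b) ^ 2
          - 6 * θ * c * K * l2norm (pinv A *ᵥ b) ^ 2)
        + 6 * θ * c * K * l2norm (pinv A *ᵥ b) ^ 2 := by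
  have hK0 : 0 < K := by linarith
  induction t generalizing l with
  | zero => simp [tapeExp]
  | succ t ih =>
    have h1 := (sum_pairProb_mul_error_le hA hK hK0 hθ hb hc hcK l).1
    rw [tapeExp]
    refine (Finset.sum_le_sum fun ω _ => mul_le_mul_of_nonneg_left (ih (ω :: l))
      (pairProb_nonneg A ω)).trans ?_
    have hq : 0 ≤ 1 - c / K := by
      rw [sub_nonneg, div_le_one hK0]
      nlinarith
    set β := 6 * θ * c * K * l2norm (pinv A *ᵥ b) ^ 2 with hβ
    have h2 : 6 * θ * c ^ 2 * l2norm (pinv A *ᵥ b) ^ 2 = c / K * β := by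
      rw [hβ]; field_simp
    rw [h2] at h1
    calc ∑ ω, pairProb A ω * ((1 - c / K) ^ t *
          (l2norm (iter A b c (ω :: l) - pinv A *ᵥ b) ^ 2 - β) + β)
        = (1 - c / K) ^ t * (∑ ω, pairProb A ω *
            l2norm (iter A b c (ω :: l) - pinv A *ᵥ b) ^ 2 - (∑ ω, pairProb A ω) * β)
            + (∑ ω, pairProb A ω) * β := by
          rw [Finset.sum_mul, ← Finset.sum_sub_distrib, Finset.mul_sum, ← Finset.sum_add_distrib]
          exact Finset.sum_congr rfl fun ω _ => by ring
      _ ≤ (1 - c / K) ^ t * ((1 - c / K) * l2norm (iter A b c l - pinv A *ᵥ b) ^ 2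
            + c / K * β - β) + β := by
          rw [sum_pairProb hA, one_mul]
          gcongr
      _ = _ := by ring

/-- The expected sum of the squared step lengths; up to the transient term it is `N` times the noise
of a single step. -/
theorem tapeExp_stepMass_le (hA : A ≠ 0) {K θ : ℝ}
    (hK : ∀ w, frobNorm A ^ 2 * l2norm (Aᴴ *ᵥ w) ^ 2 ≤ K * l2norm (A *ᵥ (Aᴴ *ᵥ w)) ^ 2)
    (hK1 : 1 ≤ K) (hθ : 1 ≤ θ)
    (hb : l2norm b ^ 2 ≤ θ * frobNorm A ^ 2 * l2norm (pinv A *ᵥ b) ^ 2)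
    (hc : 0 < c) (hcK : 4 * c * K ≤ 1) (t : ℕ) (l : List (Fin m × Fin n)) :
    tapeExp A t (stepMass A b c) l ≤ stepMass A b c l
      + 4 * c * K * l2norm (iter A b c l - pinv A *ᵥ b) ^ 2
      + t * (12 * θ * c ^ 2 * l2norm (pinv A *ᵥ b) ^ 2) := by
  have hK0 : 0 < K := by linarith
  induction t generalizing l with
  | zero =>
    simp only [tapeExp, Nat.cast_zero, zero_mul, add_zero, le_add_iff_nonneg_right]
    positivity
  | succ t ih =>
    -- the potential `stepMass + 4 c K * error` grows by at most a constant per step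
    obtain ⟨h1, h2⟩ := sum_pairProb_mul_error_le hA hK hK0 hθ hb hc hcK l
    rw [tapeExp]
    refine (Finset.sum_le_sum fun ω _ => mul_le_mul_of_nonneg_left (ih (ω :: l))
      (pairProb_nonneg A ω)).trans ?_
    set X := l2norm (pinv A *ᵥ b) ^ 2 with hX
    have h3 : ∑ ω, pairProb A ω * (stepMass A b c (ω :: l)
        + 4 * c * K * l2norm (iter A b c (ω :: l) - pinv A *ᵥ b) ^ 2
        + t * (12 * θ * c ^ 2 * X)) = ∑ ω, pairProb A ω * stepMass A b c (ω :: l)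
        + 4 * c * K * ∑ ω, pairProb A ω * l2norm (iter A b c (ω :: l) - pinv A *ᵥ b) ^ 2
        + t * (12 * θ * c ^ 2 * X) := by
      conv_rhs => rw [← sum_pairProb_mul_const hA (t * (12 * θ * c ^ 2 * X))]
      rw [Finset.mul_sum, ← Finset.sum_add_distrib, ← Finset.sum_add_distrib]
      exact Finset.sum_congr rfl fun ω _ => by ring
    rw [h3]
    have h4 : 4 * c * K * ((1 - c / K) * l2norm (iter A b c l - pinv A *ᵥ b) ^ 2
        + 6 * θ * c ^ 2 * X) = 4 * c * K * l2norm (iter A b c l - pinv A *ᵥ b) ^ 2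
        - 4 * c ^ 2 * l2norm (iter A b c l - pinv A *ᵥ b) ^ 2
        + 4 * c * K * (6 * θ * c ^ 2 * X) := by
      field_simp
    have h5 : 4 * c * K * (6 * θ * c ^ 2 * X) ≤ 6 * θ * c ^ 2 * X :=
      mul_le_of_le_one_left (by positivity) hcK
    have h6 : 4 * c * K * ∑ ω, pairProb A ω * l2norm (iter A b c (ω :: l) - pinv A *ᵥ b) ^ 2 ≤
        4 * c * K * ((1 - c / K) * l2norm (iter A b c l - pinv A *ᵥ b) ^ 2
        + 6 * θ * c ^ 2 * X) := by gcongr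
    push_cast
    linarith

/-- The weight with which `j` is output: `‖x j‖²` for the iterate `x`, cut off where the rejection
step cannot reach it. -/
noncomputable def cutWeight (A : Matrix (Fin m) (Fin n) ℂ) (b : Fin m → ℂ) (c L : ℝ)
    (l : List (Fin m × Fin n)) (j : Fin n) : ℝ :=
  min (‖iter A b c l j‖ ^ 2) (L * profile A l j)

/-- Deviation of the weights from `‖x⋆ j‖²` in terms of the error of the iterate; the cut is
effective only if `stepMass` exceeds `L`, and then the last term dominates. -/
theorem sum_abs_cutWeight_sub_le {L s : ℝ} (hL : 0 < L) (hs : 0 < s)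
    (l : List (Fin m × Fin n)) (xs : Fin n → ℂ) :
    ∑ j, |cutWeight A b c L l j - ‖xs j‖ ^ 2| ≤
      (1 + 1 / s) * l2norm (iter A b c l - xs) ^ 2
        + (s * l2norm xs ^ 2 + l2norm xs ^ 2 / L * stepMass A b c l) := by
  set x := iter A b c l with hx
  have hM := stepMass_nonneg A b c l
  have key (j : Fin n) : |cutWeight A b c L l j - ‖xs j‖ ^ 2| ≤
      (1 + 1 / s) * ‖(x - xs) j‖ ^ 2
        + (s * ‖xs j‖ ^ 2 + ‖xs j‖ ^ 2 / L * stepMass A b c l) := by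
    have h1 : |‖x j‖ ^ 2 - ‖xs j‖ ^ 2| ≤
        (1 + 1 / s) * ‖(x - xs) j‖ ^ 2 + s * ‖xs j‖ ^ 2 := by
      have h2 : |‖x j‖ - ‖xs j‖| ≤ ‖(x - xs) j‖ := abs_norm_sub_norm_le _ _
      have h3 : ‖x j‖ ≤ ‖(x - xs) j‖ + ‖xs j‖ := by
        have := norm_add_le ((x - xs) j) (xs j)
        simpa using this
      set p := ‖(x - xs) j‖
      set q := ‖xs j‖
      have hp : 0 ≤ p := norm_nonneg _
      have hq : 0 ≤ q := norm_nonneg _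
      have h4 : |‖x j‖ ^ 2 - q ^ 2| = |‖x j‖ - q| * (‖x j‖ + q) := by
        rw [← abs_of_nonneg (a := ‖x j‖ + q) (by positivity), ← abs_mul]
        congr 1
        ring
      have h5 : 2 * p * q ≤ 1 / s * p ^ 2 + s * q ^ 2 := by
        have : 0 ≤ (p - s * q) ^ 2 / s := by positivity
        have h6 : (p - s * q) ^ 2 / s = 1 / s * p ^ 2 + s * q ^ 2 - 2 * p * q := by
          field_simp
          ring
        linarith
      rw [h4]
      calc _ ≤ p * (p + q + q) := by gcongr
        _ ≤ _ := by nlinarith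
    have h7 : 0 ≤ ‖xs j‖ ^ 2 / L * stepMass A b c l := by positivity
    have h8 := norm_iter_sq_le A b c l j
    have h9 := profile_nonneg A l j
    rcases le_or_gt (stepMass A b c l) L with h | h
    · have h10 : cutWeight A b c L l j = ‖x j‖ ^ 2 :=
        min_eq_left (h8.trans (by gcongr))
      rw [h10]
      linarith
    · have h10 : cutWeight A b c L l j ≤ ‖x j‖ ^ 2 := min_le_left _ _
      have h11 : 0 ≤ cutWeight A b c L l j := le_min (by positivity) (by positivity)
      have h12 : ‖xs j‖ ^ 2 ≤ ‖xs j‖ ^ 2 / L * stepMass A b c l := by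
        rw [div_mul_eq_mul_div, le_div_iff₀ hL]
        gcongr
      have h13 : 0 ≤ (1 + 1 / s) * ‖(x - xs) j‖ ^ 2 + s * ‖xs j‖ ^ 2 := by positivity
      rw [abs_le] at h1 ⊢
      constructor <;> linarith [h1.1, h1.2]
  refine (Finset.sum_le_sum fun j _ => key j).trans_eq ?_
  rw [Finset.sum_add_distrib, Finset.sum_add_distrib, ← Finset.mul_sum, ← Finset.mul_sum,
    ← Finset.sum_mul, ← Finset.sum_div, ← l2norm_sq, ← l2norm_sq]

/-- With step size `c`, `N` steps and cut-off `L` as below, the expected weights are within the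
fraction `u` of the ideal ones. -/
theorem sum_abs_tapeExp_cutWeight_sub_le (hA : A ≠ 0) {K θ u L : ℝ} {N : ℕ}
    (hK : ∀ w, frobNorm A ^ 2 * l2norm (Aᴴ *ᵥ w) ^ 2 ≤ K * l2norm (A *ᵥ (Aᴴ *ᵥ w)) ^ 2)
    (hK1 : 1 ≤ K) (hθ : 1 ≤ θ)
    (hb : l2norm b ^ 2 ≤ θ * frobNorm A ^ 2 * l2norm (pinv A *ᵥ b) ^ 2)
    (hu : 0 < u) (hu1 : u ≤ 1) (hc : c = u ^ 2 / (192 * θ * K))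
    (hN : 6144 * θ * K ^ 2 / u ^ 4 ≤ N) (hN2 : N ≤ 2 * (6144 * θ * K ^ 2 / u ^ 4))
    (hL : 20 * l2norm (pinv A *ᵥ b) ^ 2 / u ≤ L) (hL0 : 0 < L) :
    ∑ j, |tapeExp A N (fun l => cutWeight A b c L l j) [] - ‖(pinv A *ᵥ b) j‖ ^ 2| ≤
      u * l2norm (pinv A *ᵥ b) ^ 2 := by
  set xs := pinv A *ᵥ b with hxs
  set X := l2norm xs ^ 2 with hX
  have hX0 : 0 ≤ X := by positivity
  have hK0 : 0 < K := by linarith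
  have hθ0 : 0 < θ := by linarith
  have hc0 : 0 < c := by rw [hc]; positivity
  have hcK' : c * K * θ = u ^ 2 / 192 := by rw [hc]; field_simp
  have hu2 : u ^ 2 ≤ u := by nlinarith
  have hcK : 4 * c * K ≤ u ^ 2 / 48 := by
    have : c * K ≤ c * K * θ := le_mul_of_one_le_right (by positivity) hθ
    linarith
  have hcK1 : 4 * c * K ≤ 1 := by linarith
  have habs (j : Fin n) : |tapeExp A N (fun l => cutWeight A b c L l j) [] - ‖xs j‖ ^ 2| ≤
      tapeExp A N (fun l => |cutWeight A b c L l j - ‖xs j‖ ^ 2|) [] := by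
    rw [abs_sub_le_iff]
    have e1 := tapeExp_const hA (‖xs j‖ ^ 2) N []
    constructor
    · have := tapeExp_mono A (t := N) (l := []) (f := fun l => cutWeight A b c L l j)
        (g := fun l => |cutWeight A b c L l j - ‖xs j‖ ^ 2| + ‖xs j‖ ^ 2) fun l _ => by
          linarith [le_abs_self (cutWeight A b c L l j - ‖xs j‖ ^ 2)]
      rw [tapeExp_add, e1] at this
      linarith
    · have := tapeExp_mono A (t := N) (l := []) (f := fun _ => ‖xs j‖ ^ 2)
        (g := fun l => |cutWeight A b c L l j - ‖xs j‖ ^ 2| + cutWeight A b c L l j) fun l _ => by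
          linarith [neg_le_abs (cutWeight A b c L l j - ‖xs j‖ ^ 2)]
      rw [tapeExp_add, e1] at this
      linarith
  refine (Finset.sum_le_sum fun j _ => habs j).trans ?_
  rw [← tapeExp_sum A Finset.univ fun j l => |cutWeight A b c L l j - ‖xs j‖ ^ 2|]
  refine (tapeExp_mono A fun l _ => sum_abs_cutWeight_sub_le (A := A) (b := b) (c := c) (s := u / 4)
    hL0 (by positivity) l xs).trans ?_
  rw [tapeExp_add, tapeExp_add, tapeExp_const hA, tapeExp_const_mul, tapeExp_const_mul]
  have herr := tapeExp_error_le hA hK hK1 hθ hb hc0 hcK1 N []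
  have hmass := tapeExp_stepMass_le hA hK hK1 hθ hb hc0 hcK1 N []
  have h0 : l2norm (iter A b c [] - xs) ^ 2 = X := by
    simp [iter, hX, l2norm]
  rw [← hxs, h0, ← hX] at herr hmass
  -- `N c / K ≥ 32 / u²`, and `(1 - a) ^ N (1 + N a) ≤ ((1 - a) (1 + a)) ^ N ≤ 1` for `a = c / K`
  have hpow : (1 - c / K) ^ N ≤ u ^ 2 / 32 := by
    have ha0 : 0 < c / K := by positivity
    have ha1 : 0 ≤ 1 - c / K := by
      rw [sub_nonneg, div_le_one hK0]; nlinarith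
    have h1 : 1 + (N : ℝ) * (c / K) ≤ (1 + c / K) ^ N :=
      one_add_mul_le_pow (by linarith) N
    have h2 : (1 - c / K) ^ N * (1 + c / K) ^ N ≤ 1 := by
      rw [← mul_pow]
      exact pow_le_one₀ (by positivity) (by nlinarith)
    have h3 : 32 / u ^ 2 ≤ N * (c / K) := by
      calc 32 / u ^ 2 = 6144 * θ * K ^ 2 / u ^ 4 * (c / K) := by
            rw [hc]; field_simp; norm_num
        _ ≤ _ := by gcongr
    have h4 : (1 - c / K) ^ N * (32 / u ^ 2) ≤ 1 :=
      le_trans (by gcongr; linarith) h2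
    calc (1 - c / K) ^ N = (1 - c / K) ^ N * (32 / u ^ 2) * (u ^ 2 / 32) := by field_simp
      _ ≤ 1 * (u ^ 2 / 32) := by gcongr
      _ = _ := one_mul _
  have herr' : tapeExp A N (fun l => l2norm (iter A b c l - xs) ^ 2) [] ≤ u ^ 2 / 16 * X := by
    have h1 : 6 * θ * c * K * X = u ^ 2 / 32 * X := by
      have : 6 * θ * c * K * X = 6 * (c * K * θ) * X := by ring
      rw [this, hcK']; ring
    rw [h1] at herr
    have h2 : (1 - c / K) ^ N * (X - u ^ 2 / 32 * X) ≤ u ^ 2 / 32 * X := by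
      have h3 : 0 ≤ X - u ^ 2 / 32 * X := by nlinarith
      calc _ ≤ u ^ 2 / 32 * (X - u ^ 2 / 32 * X) := by gcongr
        _ ≤ _ := by
          gcongr
          have : 0 ≤ u ^ 2 / 32 * X := by positivity
          linarith
    linarith
  have hmass' : tapeExp A N (stepMass A b c) [] ≤ 5 * X := by
    have h1 : (N : ℝ) * (12 * θ * c ^ 2 * X) ≤ 4 * X := by
      calc _ ≤ 2 * (6144 * θ * K ^ 2 / u ^ 4) * (12 * θ * c ^ 2 * X) := by gcongr
        _ = 147456 / u ^ 4 * (c * K * θ) ^ 2 * X := by ring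
        _ = 4 * X := by rw [hcK']; field_simp; ring
    have h2 : 4 * c * K * X ≤ X := mul_le_of_le_one_left hX0 hcK1
    simp only [stepMass] at hmass
    linarith
  -- Markov's inequality for the event that the cut is effective
  have hlast : X / L * tapeExp A N (stepMass A b c) [] ≤ u / 4 * X := by
    calc _ ≤ X / L * (5 * X) := by gcongr
      _ ≤ u / 4 * X := by
        rw [div_mul_eq_mul_div, div_le_iff₀ hL0]
        rw [div_le_iff₀ hu] at hL
        nlinarith
  have hfirst : (1 + 1 / (u / 4)) * tapeExp A N (fun l => l2norm (iter A b c l - xs) ^ 2) [] ≤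
      (u / 16 + u / 4) * X := by
    calc _ ≤ (1 + 1 / (u / 4)) * (u ^ 2 / 16 * X) := by gcongr
      _ = (u ^ 2 / 16 + u / 4) * X := by field_simp; ring
      _ ≤ _ := by gcongr
  nlinarith [mul_nonneg hu.le hX0]

end Convergence

/-! ### Laws of the samples and of an attempt -/

noncomputable section Laws

theorem PMF.toReal_bind_apply {α β : Type*} [Fintype α] (p : PMF α) (g : α → PMF β) (o : β) :
    (p.bind g o).toReal = ∑ a, (p a).toReal * (g a o).toReal := by
  rw [PMF.bind_apply, tsum_fintype, ENNReal.toReal_sum]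
  · simp only [ENNReal.toReal_mul]
  · exact fun a _ => ENNReal.mul_ne_top (p.apply_ne_top a) ((g a).apply_ne_top o)

theorem PMF.sum_toReal {α : Type*} [Fintype α] (p : PMF α) : ∑ a, (p a).toReal = 1 := by
  rw [← ENNReal.toReal_sum fun a _ => p.apply_ne_top a,
    ← tsum_fintype (L := .unconditional _), p.tsum_coe, ENNReal.toReal_one]

open Classical in
/-- `weightedIndex` as a law on the index set itself. -/
def indexLaw {d : ℕ} [NeZero d] (w : Fin d → ℝ≥0) : PMF (Fin d) :=
  if h : (∑' i, (w i : ℝ≥0∞)) = 0 then PMF.pure 0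
    else PMF.normalize (fun i => (w i : ℝ≥0∞)) h
      (by rw [tsum_fintype]; exact ENNReal.sum_ne_top.2 fun i _ => ENNReal.coe_ne_top)

theorem weightedIndex_eq_map {d : ℕ} [NeZero d] (w : Fin d → ℝ≥0) :
    weightedIndex w = (indexLaw w).map Fin.val := by
  unfold weightedIndex indexLaw
  split_ifs
  · rw [PMF.pure_map]; rfl
  · rfl

theorem toReal_indexLaw_apply {d : ℕ} [NeZero d] {w : Fin d → ℝ≥0} (hw : ∑ i, w i ≠ 0)
    (i : Fin d) : (indexLaw w i).toReal = w i / ∑ i, (w i : ℝ) := by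
  have h : (∑' i, (w i : ℝ≥0∞)) = ((∑ i, w i : ℝ≥0) : ℝ≥0∞) := by
    rw [tsum_fintype]; push_cast; rfl
  have h0 : (∑' i, (w i : ℝ≥0∞)) ≠ 0 := by
    rw [h]; exact_mod_cast hw
  rw [indexLaw, dif_neg h0, PMF.normalize_apply, h, ENNReal.toReal_mul, ENNReal.toReal_inv,
    ENNReal.coe_toReal, ENNReal.coe_toReal, NNReal.coe_sum, div_eq_mul_inv]

theorem toReal_biasedCoin_bind {β : Type*} {p : ℝ} (hp : 0 ≤ p) (g : ℕ → PMF β) (o : β) :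
    ((biasedCoin p).bind g o).toReal =
      min p 1 * (g 1 o).toReal + (1 - min p 1) * (g 0 o).toReal := by
  set w : Fin 2 → ℝ≥0 := ![1 - min p.toNNReal 1, min p.toNNReal 1] with hw
  have hs : ∑ i, w i = 1 := by
    simp [hw, Fin.sum_univ_two, tsub_add_cancel_of_le]
  have hs' : ∑ i, (w i : ℝ) = 1 := by exact_mod_cast hs
  have h1 : (w 1 : ℝ) = min p 1 := by simp [hw, hp]
  have h0 : (w 0 : ℝ) = 1 - min p 1 := by rw [← h1, ← hs', Fin.sum_univ_two]; ring
  rw [biasedCoin, weightedIndex_eq_map, PMF.bind_map, PMF.toReal_bind_apply, Fin.sum_univ_two,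
    toReal_indexLaw_apply (by rw [hs]; exact one_ne_zero),
    toReal_indexLaw_apply (by rw [hs]; exact one_ne_zero), hs', ← hw, h0, h1]
  simp
  ring

variable {m n : ℕ} (A : Matrix (Fin m) (Fin n) ℂ) (b : Fin m → ℂ) (c : ℝ)

/-- The law of a row index drawn by squared row norms. -/
def rowLaw [NeZero m] : PMF (Fin m) := indexLaw fun i => ∑ j, ‖A i j‖₊ ^ 2

/-- The law of a column index drawn from `𝒟` of row `r`. -/
def colLaw [NeZero n] (r : Fin m) : PMF (Fin n) := indexLaw fun j => ‖A r j‖₊ ^ 2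

/-- The law of the list of samples after `t` further samples. -/
def tapeLaw [NeZero m] [NeZero n] : ℕ → List (Fin m × Fin n) → PMF (List (Fin m × Fin n))
  | 0, l => PMF.pure l
  | t + 1, l => (rowLaw A).bind fun r => (colLaw A r).bind fun j => tapeLaw t ((r, j) :: l)

/-- A row drawn uniformly from the list of samples, by successive coin tosses with bias
`1 / (number of samples left)`; `r` is the result for the empty list. -/
def pickLaw : Fin m → List (Fin m × Fin n) → PMF (Fin m)
  | r, [] => PMF.pure r
  | _, ω :: l => (biasedCoin (1 / (l.length + 1))).bind fun v =>
      if v = 0 then pickLaw ω.1 l else PMF.pure ω.1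

/-- The law of the outcome of a single attempt: `N` gradient steps, then rejection sampling from the
squared moduli of the iterate, a proposal `j` being drawn from a random one of the sampled rows. -/
def attemptLaw [NeZero m] [NeZero n] (L : ℝ) (N : ℕ) : PMF (Option (Fin n)) :=
  (tapeLaw A N []).bind fun l => (pickLaw 0 l).bind fun r => (colLaw A r).bind fun j =>
    (biasedCoin (‖iter A b c l j‖ ^ 2 / (L * profile A l j))).bind fun v =>
      PMF.pure (if v = 0 then none else some j)

theorem toReal_colLaw_apply [NeZero n] {r : Fin m} (hr : A r ≠ 0) (j : Fin n) :
    (colLaw A r j).toReal = sqDist (A r) j := by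
  have h : (∑ j, ‖A r j‖₊ ^ 2 : ℝ≥0) ≠ 0 := by
    intro h
    refine hr (funext fun j => ?_)
    have := (Finset.sum_eq_zero_iff.1 h) j (Finset.mem_univ j)
    simpa using this
  rw [colLaw, toReal_indexLaw_apply h, sqDist, l2norm_sq]
  simp

variable {A} in
theorem toReal_rowLaw_apply [NeZero m] (hA : A ≠ 0) (r : Fin m) :
    (rowLaw A r).toReal = l2norm (A r) ^ 2 / frobNorm A ^ 2 := by
  have h : (∑ i, ∑ j, ‖A i j‖₊ ^ 2 : ℝ≥0) ≠ 0 := by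
    intro h
    refine hA (Matrix.ext fun i j => ?_)
    have := Finset.sum_eq_zero_iff.1 ((Finset.sum_eq_zero_iff.1 h) i (Finset.mem_univ i)) j
      (Finset.mem_univ j)
    simpa using this
  rw [rowLaw, toReal_indexLaw_apply h, l2norm_sq, frobNorm_sq]
  simp

variable {A} in
theorem toReal_rowLaw_mul_colLaw [NeZero m] [NeZero n] (hA : A ≠ 0) (r : Fin m) (j : Fin n) :
    (rowLaw A r).toReal * (colLaw A r j).toReal = pairProb A (r, j) := by
  rw [toReal_rowLaw_apply hA, pairProb]
  rcases eq_or_ne (A r) 0 with h | h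
  · simp [h, l2norm]
  · rw [toReal_colLaw_apply A h, sqDist]
    have : l2norm (A r) ≠ 0 := mt l2norm_eq_zero.1 h
    field_simp

variable {A} in
/-- `tapeExp` is the expectation under `tapeLaw`. -/
theorem toReal_tapeLaw_bind [NeZero m] [NeZero n] {β : Type*} (hA : A ≠ 0)
    (g : List (Fin m × Fin n) → PMF β) (o : β) (t : ℕ) (l : List (Fin m × Fin n)) :
    ((tapeLaw A t l).bind g o).toReal = tapeExp A t (fun l => (g l o).toReal) l := by
  induction t generalizing l with
  | zero => rw [tapeLaw, PMF.pure_bind, tapeExp]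
  | succ t ih =>
    rw [tapeLaw, PMF.bind_bind, PMF.toReal_bind_apply, tapeExp, Fintype.sum_prod_type]
    refine Finset.sum_congr rfl fun r _ => ?_
    rw [PMF.bind_bind, PMF.toReal_bind_apply, Finset.mul_sum]
    refine Finset.sum_congr rfl fun j _ => ?_
    rw [ih, ← mul_assoc, toReal_rowLaw_mul_colLaw hA]

/-- `pickLaw` is uniform. Multiplying by the length makes this true of the empty list, too. -/
theorem length_mul_toReal_pickLaw_bind {β : Type*} (g : Fin m → PMF β) (o : β) (r : Fin m)
    (l : List (Fin m × Fin n)) :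
    l.length * ((pickLaw r l).bind g o).toReal = (l.map fun ω => (g ω.1 o).toReal).sum := by
  induction l generalizing r with
  | nil => simp
  | cons ω l ih =>
    have h1 : min (1 / ((l.length : ℝ) + 1)) 1 = 1 / ((l.length : ℝ) + 1) := by
      apply min_eq_left
      rw [div_le_one (by positivity)]
      linarith [(Nat.cast_nonneg l.length : (0 : ℝ) ≤ l.length)]
    rw [pickLaw, PMF.bind_bind, toReal_biasedCoin_bind (by positivity), h1, List.map_cons,
      List.sum_cons, ← ih ω.1]
    simp only [one_ne_zero, if_false, if_true, PMF.pure_bind, List.length_cons]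
    push_cast
    field_simp
    ring

theorem sum_map_sqDist_eq_profile (l : List (Fin m × Fin n)) (j : Fin n) :
    (l.map fun ω => sqDist (A ω.1) j).sum = profile A l j := by
  induction l with
  | nil => rfl
  | cons ω l ih => rw [List.map_cons, List.sum_cons, ih, profile, add_comm]

/-- Samples of probability `0` do not contribute to the expectation. -/
theorem tapeExp_congr {f g : List (Fin m × Fin n) → ℝ} {t : ℕ} {l : List (Fin m × Fin n)}
    (h : ∀ l', l'.length = l.length + t → (∀ ω ∈ l', A ω.1 ≠ 0) → f l' = g l')
    (hl : ∀ ω ∈ l, A ω.1 ≠ 0) : tapeExp A t f l = tapeExp A t g l := by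
  induction t generalizing l with
  | zero => exact h l (by simp) hl
  | succ t ih =>
    refine Finset.sum_congr rfl fun ω _ => ?_
    rcases eq_or_ne (A ω.1) 0 with h0 | h0
    · simp [pairProb, h0]
    · rw [ih (fun l' hl' => h l' (by simp at hl'; omega))]
      simpa [h0] using hl

variable {A} in
/-- The expected acceptance probability: the proposal has density `profile / N`, so that rejection
leaves the weight `min (‖x j‖² / L) (profile j) / N`. -/
theorem toReal_attemptLaw_some [NeZero m] [NeZero n] (hA : A ≠ 0) {L : ℝ}
    (hL : 0 < L) {N : ℕ} (hN : 0 < N) (j : Fin n) : (attemptLaw A b c L N (some j)).toReal =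
      tapeExp A N (fun l => cutWeight A b c L l j) [] / (N * L) := by
  have hN' : (N : ℝ) ≠ 0 := by exact_mod_cast hN.ne'
  rw [attemptLaw, toReal_tapeLaw_bind hA, eq_div_iff (by positivity), mul_comm,
    ← tapeExp_const_mul]
  refine tapeExp_congr A (fun l hl hrow => ?_) (by simp)
  have hl' : l.length = N := by simpa using hl
  set a : Fin n → ℝ := fun j => ‖iter A b c l j‖ ^ 2 / (L * profile A l j) with ha
  have ha0 (j) : 0 ≤ a j := div_nonneg (by positivity) (mul_nonneg hL.le (profile_nonneg A l j))
  have h1 (r : Fin m) (hr : A r ≠ 0) : (((colLaw A r).bind fun j =>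
      (biasedCoin (a j)).bind fun v =>
        PMF.pure (if v = 0 then none else some j)) (some j)).toReal =
      sqDist (A r) j * min (a j) 1 := by
    rw [PMF.toReal_bind_apply, Finset.sum_eq_single j]
    · rw [toReal_colLaw_apply A hr, toReal_biasedCoin_bind (ha0 j)]
      simp [PMF.pure_apply]
    · intro j' _ hj'
      rw [toReal_biasedCoin_bind (ha0 j')]
      simp [PMF.pure_apply, hj'.symm]
    · simp
  have h2 := length_mul_toReal_pickLaw_bind (fun r => (colLaw A r).bind fun j =>
      (biasedCoin (a j)).bind fun v =>
        PMF.pure (if v = 0 then none else some j)) (some j) 0 l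
  rw [hl', List.map_congr_left (g := fun ω => sqDist (A ω.1) j * min (a j) 1)
    fun ω hω => h1 ω.1 (hrow ω hω), List.sum_map_mul_right, sum_map_sqDist_eq_profile] at h2
  rw [mul_comm (N : ℝ) L, mul_assoc, h2, cutWeight, ha]
  have h3 := norm_iter_sq_le A b c l j
  rcases (profile_nonneg A l j).eq_or_lt' with h | h
  · have : ‖iter A b c l j‖ ^ 2 = 0 := le_antisymm (by simpa [h] using h3) (by positivity)
    simp [h]
  · rw [← mul_assoc, mul_min_of_nonneg _ _ (by positivity), mul_one]
    congr 1
    field_simp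

/-! ### Independent repetitions -/

/-- Repeat until the first success, at most `d` times. -/
def repeatLaw {α : Type*} (ν : PMF (Option α)) : ℕ → PMF (Option α)
  | 0 => PMF.pure none
  | d + 1 => ν.bind fun o => o.elim (repeatLaw ν d) fun j => PMF.pure (some j)

theorem toReal_repeatLaw_some {α : Type*} [Fintype α] (ν : PMF (Option α)) (d : ℕ) (j : α) :
    (repeatLaw ν d (some j)).toReal =
      (ν (some j)).toReal * ∑ i ∈ Finset.range d, (ν none).toReal ^ i := by
  classical
  induction d with
  | zero => simp [repeatLaw, PMF.pure_apply]
  | succ d ih =>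
    rw [repeatLaw, PMF.toReal_bind_apply, Fintype.sum_option, Option.elim_none, ih,
      Finset.sum_eq_single j]
    · rw [Finset.sum_range_succ', Option.elim_some, PMF.pure_apply_self]
      simp only [pow_succ, ← Finset.sum_mul]
      simp
      ring
    · intro i _ hi
      simp [PMF.pure_apply, hi.symm]
    · simp

theorem toReal_apply_none (ν : PMF (Option (Fin n))) :
    (ν none).toReal = 1 - RAM.successProb ν := by
  have := PMF.sum_toReal ν
  rw [Fintype.sum_option] at this
  rw [RAM.successProb]
  linarith

theorem successProb_repeatLaw (ν : PMF (Option (Fin n))) (d : ℕ) :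
    RAM.successProb (repeatLaw ν d) = RAM.successProb ν *
      ∑ i ∈ Finset.range d, (ν none).toReal ^ i := by
  simp only [RAM.successProb, toReal_repeatLaw_some, Finset.sum_mul]

end Laws

namespace RAM

/-! ### Program logic -/

/-- `Sim M ρ R`: the computation `M` surely finishes, and its final state can be coupled with a
random value of law `ρ` such that value and state are always related by `R`. -/
def Sim {α : Type} (M : PMF (Option State)) (ρ : PMF α) (R : α → State → Prop) : Prop :=
  ∃ κ : PMF (α × State), κ.map Prod.fst = ρ ∧ M = κ.map (fun p => some p.2) ∧
    ∀ p ∈ κ.support, R p.1 p.2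

theorem andThen_pure (s : State) (f : State → PMF (Option State)) :
    andThen (PMF.pure (some s)) f = f s := by
  rw [andThen, PMF.pure_bind]; rfl

theorem Sim.pure {α : Type} {a : α} {s : State} {R : α → State → Prop} (h : R a s) :
    Sim (PMF.pure (some s)) (PMF.pure a) R := by
  refine ⟨PMF.pure (a, s), PMF.pure_map _ _,
    (PMF.pure_map (fun p : α × State => some p.2) (a, s)).symm, ?_⟩
  rintro p hp
  rw [PMF.mem_support_pure_iff] at hp
  subst hp
  exact h

theorem Sim.map {α : Type} {ρ : PMF α} {f : α → State} {R : α → State → Prop}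
    (h : ∀ a, R a (f a)) : Sim (ρ.map fun a => some (f a)) ρ R := by
  refine ⟨ρ.map fun a => (a, f a), ?_, ?_, ?_⟩
  · rw [PMF.map_comp]
    exact PMF.map_id ρ
  · rw [PMF.map_comp]
    rfl
  · rintro p hp
    obtain ⟨a, -, rfl⟩ := (PMF.mem_support_map_iff _ _ _).1 hp
    exact h a

theorem Sim.mono {α : Type} {M : PMF (Option State)} {ρ : PMF α} {R R' : α → State → Prop}
    (h : Sim M ρ R) (hR : ∀ a s, R a s → R' a s) : Sim M ρ R' := by
  obtain ⟨κ, h1, h2, h3⟩ := h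
  exact ⟨κ, h1, h2, fun p hp => hR _ _ (h3 p hp)⟩

/-- Sequential composition: couplings compose along the random values. -/
theorem Sim.andThen {α β : Type} {M : PMF (Option State)} {ρ : PMF α} {R : α → State → Prop}
    {f : State → PMF (Option State)} {ρ' : α → PMF β} {R' : β → State → Prop}
    (h : Sim M ρ R) (hf : ∀ a s, R a s → Sim (f s) (ρ' a) R') :
    Sim (andThen M f) (ρ.bind ρ') R' := by
  classical
  obtain ⟨κ, rfl, rfl, h3⟩ := h
  have hg : ∀ p : α × State, ∃ κ' : PMF (β × State), p ∈ κ.support →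
      κ'.map Prod.fst = ρ' p.1 ∧ f p.2 = κ'.map (fun p => some p.2) ∧
        ∀ q ∈ κ'.support, R' q.1 q.2 := by
    intro p
    by_cases hp : p ∈ κ.support
    · obtain ⟨κ', h⟩ := hf _ _ (h3 p hp)
      exact ⟨κ', fun _ => h⟩
    · obtain ⟨b, -⟩ := (ρ' p.1).support_nonempty
      exact ⟨PMF.pure (b, p.2), fun h => absurd h hp⟩
  choose g hg using hg
  have hcongr {γ : Type} (u v : α × State → PMF γ) (huv : ∀ p ∈ κ.support, u p = v p) :
      κ.bind u = κ.bind v := by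
    ext c
    simp only [PMF.bind_apply]
    refine tsum_congr fun p => ?_
    by_cases hp : p ∈ κ.support
    · rw [huv p hp]
    · rw [(κ.apply_eq_zero_iff p).2 hp, zero_mul, zero_mul]
  refine ⟨κ.bind g, ?_, ?_, ?_⟩
  · rw [PMF.map_bind, PMF.bind_map]
    exact hcongr _ _ fun p hp => (hg p hp).1
  · rw [PMF.map_bind, RAM.andThen, PMF.bind_map]
    exact hcongr _ _ fun p hp => (hg p hp).2.1
  · intro q hq
    obtain ⟨p, hp, hq⟩ := (PMF.mem_support_bind_iff _ _ _).1 hq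
    exact (hg p hp).2.2 q hq

theorem runLoop_of_holds {t : Test} {body : State → PMF (Option State)} {fuel : ℕ} {s : State}
    (hf : 0 < fuel) (h : t.holds s) :
    runLoop t body fuel s = RAM.andThen (body (s.tick t.cost)) (runLoop t body (fuel - 1)) := by
  obtain ⟨fuel, rfl⟩ := Nat.exists_eq_succ_of_ne_zero hf.ne'
  rw [runLoop, if_pos h]
  rfl

theorem runLoop_of_not_holds {t : Test} {body : State → PMF (Option State)} {fuel : ℕ} {s : State}
    (hf : 0 < fuel) (h : ¬ t.holds s) :
    runLoop t body fuel s = PMF.pure (some (s.tick t.cost)) := by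
  obtain ⟨fuel, rfl⟩ := Nat.exists_eq_succ_of_ne_zero hf.ne'
  rw [runLoop, if_neg h]

theorem one_le_accessTime (m n : ℕ) : 1 ≤ accessTime m n := Nat.one_le_pow _ _ (Nat.succ_pos _)

theorem mem_support_andThen {μ : PMF (Option State)} {f : State → PMF (Option State)} {s' : State}
    (h : some s' ∈ (andThen μ f).support) : ∃ s, some s ∈ μ.support ∧ some s' ∈ (f s).support := by
  obtain ⟨o, ho, h⟩ := (PMF.mem_support_bind_iff _ _ _).1 h
  cases o with
  | none => simp at h
  | some s => exact ⟨s, ho, h⟩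

theorem queries_le_time_of_mem_support_runLoop {t : Test} {body : State → PMF (Option State)}
    (hbody : ∀ s s', s.queries ≤ s.time → some s' ∈ (body s).support → s'.queries ≤ s'.time)
    (fuel : ℕ) {s s' : State} (hs : s.queries ≤ s.time)
    (h : some s' ∈ (runLoop t body fuel s).support) : s'.queries ≤ s'.time := by
  have htick (s : State) (hs : s.queries ≤ s.time) :
      (s.tick t.cost).queries ≤ (s.tick t.cost).time :=
    le_add_right hs
  induction fuel generalizing s with
  | zero => simp [runLoop] at h
  | succ fuel ih =>
    rw [runLoop] at h
    split_ifs at h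
    · obtain ⟨s1, h1, h2⟩ := mem_support_andThen h
      exact ih (hbody _ _ (htick s hs) h1) h2
    · simp only [PMF.mem_support_pure_iff, Option.some.injEq] at h
      subst h
      exact htick s hs

/-- Every access takes at least one unit of time, so the number of queries is bounded by the
running time. -/
theorem queries_le_time_of_mem_support_exec {m n : ℕ} {A : Matrix (Fin m) (Fin n) ℂ}
    {b : Fin m → ℂ} {fuel : ℕ} (c : Cmd) {s s' : State} (hs : s.queries ≤ s.time)
    (h : some s' ∈ (exec A b fuel c s).support) : s'.queries ≤ s'.time := by
  have hτ := one_le_accessTime m n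
  induction c generalizing s s' with
  | skip | setIdx a e | setNum a e =>
    simp only [exec, PMF.mem_support_pure_iff, Option.some.injEq] at h
    subst h
    simp only [State.tick, State.writeIdx, State.writeNum]
    omega
  | flip a p =>
    simp only [exec, PMF.mem_support_map_iff, Option.some.injEq] at h
    obtain ⟨v, -, rfl⟩ := h
    simp only [State.tick, State.writeIdx]
    omega
  | query a q =>
    simp only [exec, PMF.mem_support_pure_iff, Option.some.injEq] at h
    subst h
    simp only [State.tick, State.writeNum, State.count]
    omega
  | sample a q =>
    simp only [exec, PMF.mem_support_map_iff, Option.some.injEq] at h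
    obtain ⟨v, -, rfl⟩ := h
    simp only [State.tick, State.writeIdx, State.count]
    omega
  | seq c d ihc ihd =>
    obtain ⟨s1, h1, h2⟩ := mem_support_andThen h
    exact ihd (ihc hs h1) h2
  | cond t c d ihc ihd =>
    have hs' : (s.tick t.cost).queries ≤ (s.tick t.cost).time := by
      simp only [State.tick]; omega
    rw [exec] at h
    split_ifs at h
    · exact ihc hs' h
    · exact ihd hs' h
  | loop t c ih =>
    exact queries_le_time_of_mem_support_runLoop (fun s s' hs h => ih hs h) fuel hs h

end RAM

namespace RAM

/-! ### The program -/

section Program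

/-- Index cell `a`. -/
def cellI (a : ℕ) : IExp := .load (.const a)

/-- Number cell `a`. -/
def cellN (a : ℕ) : NExp := .load (.const a)

/-- A natural number as a complex number. -/
def constN (k : ℕ) : NExp := .ofIdx (.const k)

/-- One summand of the sums computed by `evalCmd`. -/
def evalBody : Cmd :=
  .seq (.setIdx (.const 6) (.sub (cellI 6) (.const 1))) <|
  .seq (.query (.const 4) (.entryA (.load (.add (cellI 6) (.const 8))) (cellI 5))) <|
  .seq (.query (.const 5) (.rowNormA (.load (.add (cellI 6) (.const 8))))) <|
  .seq (.setNum (.const 7) (.add (cellN 7)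
    (.mul (.load (.add (cellI 6) (.const 14))) (.conj (cellN 4))))) <|
  .setNum (.const 8) (.add (cellN 8)
    (.div (.mul (cellN 4) (.conj (cellN 4))) (.mul (cellN 5) (cellN 5))))

/-- For `j` in index cell `5`, compute entry `j` of the iterate in number cell `7` and the entry `j`
of the profile in number cell `8`. The samples are counted by index cell `3`; their rows are in the
index cells from `8` on, the coefficients in the number cells from `14` on. -/
def evalCmd : Cmd :=
  .seq (.setNum (.const 7) (constN 0)) <|
  .seq (.setNum (.const 8) (constN 0)) <|
  .seq (.setIdx (.const 6) (cellI 3)) <|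
  .loop (.ltIdx (.const 0) (cellI 6)) evalBody

/-- Append the row in index cell `4`, with the coefficient of a step whose column is in index
cell `5`, to the stored samples. -/
def pushCmd : Cmd :=
  .seq evalCmd <|
  .seq (.query (.const 4) (.entryA (cellI 4) (cellI 5))) <|
  .seq (.query (.const 5) (.rowNormA (cellI 4))) <|
  .seq (.query (.const 6) (.entryB (cellI 4))) <|
  .seq (.setNum (.add (cellI 3) (.const 14)) (.mul (cellN 9)
    (.sub (.div (cellN 6) (.mul (cellN 5) (cellN 5))) (.div (cellN 7) (.conj (cellN 4)))))) <|
  .seq (.setIdx (.add (cellI 3) (.const 8)) (cellI 4)) <|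
  .setIdx (.const 3) (.add (cellI 3) (.const 1))

/-- One step of stochastic gradient descent. -/
def stepCmd : Cmd :=
  .seq (.sample (.const 4) .rowA) <| .seq (.sample (.const 5) (.inRowA (cellI 4))) pushCmd

/-- One round of the choice of a random stored row. -/
def pickBody : Cmd :=
  .seq (.setIdx (.const 6) (.sub (cellI 6) (.const 1))) <|
  .seq (.setIdx (.const 4) (.load (.add (cellI 6) (.const 8)))) <|
  .seq (.flip (.const 7) (.div (constN 1) (.ofIdx (.add (cellI 6) (.const 1))))) <|
  .cond (.ltIdx (.const 0) (cellI 7)) (.setIdx (.const 6) (.const 0)) .skip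

/-- Accept the proposal in index cell `5` or reject it. Acceptance stops the repetitions by clearing
number cell `13`; after a rejection that cell is multiplied by `1 - q`. -/
def acceptCmd : Cmd :=
  .seq evalCmd <|
  .seq (.flip (.const 7)
    (.div (.mul (cellN 7) (.conj (cellN 7))) (.mul (cellN 11) (cellN 8)))) <|
  .cond (.ltIdx (.const 0) (cellI 7))
    (.seq (.setIdx (.const 0) (.const 1)) <|
     .seq (.setIdx (.const 1) (cellI 5)) <|
     .setNum (.const 13) (constN 0))
    (.setNum (.const 13) (.mul (cellN 13) (.sub (constN 1) (cellN 12))))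

/-- A single attempt: gradient descent, random choice of a stored row, proposal, rejection. -/
def attemptCmd : Cmd :=
  .seq (.setIdx (.const 3) (.const 0)) <|
  .seq (.loop (.ltNum (.ofIdx (cellI 3)) (cellN 10)) stepCmd) <|
  .seq (.setIdx (.const 6) (cellI 3)) <|
  .seq (.loop (.ltIdx (.const 0) (cellI 6)) pickBody) <|
  .seq (.sample (.const 5) (.inRowA (cellI 4))) acceptCmd

end Program

/-! ### Behaviour of the parts of the program -/

section Specs
variable {m n : ℕ} {A : Matrix (Fin m) (Fin n) ℂ} {b : Fin m → ℂ} {c : ℝ} {fuel : ℕ}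

theorem exec_seq (d e : Cmd) (s : State) :
    exec A b fuel (.seq d e) s = andThen (exec A b fuel d s) (exec A b fuel e) := rfl

theorem exec_seq_of_eq {d e : Cmd} {s s' : State} (h : exec A b fuel d s = PMF.pure (some s')) :
    exec A b fuel (.seq d e) s = exec A b fuel e s' := by
  rw [exec_seq, h, andThen_pure]

theorem andThen_assoc (M : PMF (Option State)) (f g : State → PMF (Option State)) :
    andThen (andThen M f) g = andThen M fun s => andThen (f s) g := by
  simp only [andThen, PMF.bind_bind]
  congr 1
  funext o
  cases o with
  | none => simp
  | some s => rfl

/-- The samples in `l` are stored in memory, the oldest one first. -/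
def Stored (A : Matrix (Fin m) (Fin n) ℂ) (b : Fin m → ℂ) (c : ℝ) (s : State) :
    List (Fin m × Fin n) → Prop
  | [] => True
  | ω :: l => s.idx (l.length + 8) = ω.1 ∧
      s.num (l.length + 14) = stepCoef A b c (iter A b c l) ω ∧ Stored A b c s l

theorem Stored.congr {s s' : State} {l : List (Fin m × Fin n)} (h : Stored A b c s l)
    (hi : ∀ a, a < l.length → s'.idx (a + 8) = s.idx (a + 8))
    (hn : ∀ a, a < l.length → s'.num (a + 14) = s.num (a + 14)) : Stored A b c s' l := by
  induction l with
  | nil => trivial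
  | cons ω l ih =>
    obtain ⟨h1, h2, h3⟩ := h
    refine ⟨(hi _ (by simp)).trans h1, (hn _ (by simp)).trans h2, ih h3 ?_ ?_⟩
    · exact fun a ha => hi a (by simp; omega)
    · exact fun a ha => hn a (by simp; omega)

theorem exec_evalBody {s : State} {ω : Fin m × Fin n} {l : List (Fin m × Fin n)} {j : Fin n}
    (h6 : s.idx 6 = l.length + 1) (h5 : s.idx 5 = j) (hs : Stored A b c s (ω :: l)) :
    ∃ s', exec A b fuel evalBody s = PMF.pure (some s') ∧ s'.idx 6 = l.length ∧
      (∀ a, a ≠ 6 → s'.idx a = s.idx a) ∧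
      (∀ a, a ≠ 4 → a ≠ 5 → a ≠ 7 → a ≠ 8 → s'.num a = s.num a) ∧
      s'.num 7 = s.num 7 + stepCoef A b c (iter A b c l) ω * star (A ω.1 j) ∧
      s'.num 8 = s.num 8 + (sqDist (A ω.1) j : ℝ) ∧
      s'.time ≤ s.time + 90 * accessTime m n := by
  obtain ⟨h1, h2, -⟩ := hs
  have hτ := one_le_accessTime m n
  refine ⟨_, by simp only [evalBody, exec, andThen_pure]; rfl, ?_, ?_, ?_, ?_, ?_, ?_⟩
  · simp [State.tick, State.writeIdx, State.writeNum, State.count, IExp.eval, cellI, h6]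
  · intro a ha
    simp [State.tick, State.writeIdx, State.writeNum, State.count, IExp.eval, ha]
  · intro a h4 h5 h7 h8
    simp [State.tick, State.writeIdx, State.writeNum, State.count, IExp.eval, h4, h5, h7, h8]
  · simp [State.tick, State.writeIdx, State.writeNum, State.count, IExp.eval, NExp.eval, cellI,
      cellN, h6, h5, h1, h2, Query.answer]
  · have : (sqDist (A ω.1) j : ℂ) = A ω.1 j * (starRingEnd ℂ) (A ω.1 j) /
        (l2norm (A ω.1) * l2norm (A ω.1)) := by
      rw [Complex.mul_conj', sqDist]
      push_cast
      rw [sq (l2norm (A ω.1) : ℂ)]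
    simp [State.tick, State.writeIdx, State.writeNum, State.count, IExp.eval, NExp.eval, cellI,
      cellN, h6, h5, h1, Query.answer, this]
  · simp only [State.tick, State.writeIdx, State.writeNum, State.count, IExp.cost, NExp.cost,
      Query.cost, cellI, cellN]
    omega

/-- The loop runs through the samples from the newest to the oldest, hence along the list `l`. -/
theorem runLoop_evalBody {l : List (Fin m × Fin n)} {j : Fin n} {k : ℕ} (hk : l.length < k)
    {s : State} (h6 : s.idx 6 = l.length) (h5 : s.idx 5 = j) (hs : Stored A b c s l) :
    ∃ s', runLoop (.ltIdx (.const 0) (cellI 6)) (exec A b fuel evalBody) k s =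
        PMF.pure (some s') ∧
      (∀ a, a ≠ 6 → s'.idx a = s.idx a) ∧
      (∀ a, a ≠ 4 → a ≠ 5 → a ≠ 7 → a ≠ 8 → s'.num a = s.num a) ∧
      s'.num 7 = s.num 7 + iter A b c l j ∧ s'.num 8 = s.num 8 + (profile A l j : ℝ) ∧
      s'.time ≤ s.time + 100 * accessTime m n * (l.length + 1) := by
  have hτ := one_le_accessTime m n
  induction l generalizing k s with
  | nil =>
    refine ⟨_, runLoop_of_not_holds (by omega) ?_, ?_⟩
    · simp [Test.holds, IExp.eval, cellI, h6]
    · simp [State.tick, iter, profile, Test.cost, IExp.cost, cellI]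
      omega
  | cons ω l ih =>
    rw [runLoop_of_holds (by omega) (by simp [Test.holds, IExp.eval, cellI, h6])]
    obtain ⟨s1, e1, i6, fi, fn, n7, n8, ht⟩ := exec_evalBody (fuel := fuel) (j := j)
      (s := s.tick (Test.cost (.ltIdx (.const 0) (cellI 6))))
      (ω := ω) (l := l) h6 h5 (hs.congr (fun _ _ => rfl) (fun _ _ => rfl))
    rw [e1, andThen_pure]
    obtain ⟨s2, e2, gi, gn, m7, m8, ht2⟩ := ih (k := k - 1) (s := s1) (by simp at hk; omega) i6
      ((fi 5 (by norm_num)).trans h5)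
      (hs.2.2.congr (fun a _ => fi _ (by omega)) fun a _ =>
        fn _ (by omega) (by omega) (by omega) (by omega))
    refine ⟨s2, e2, fun a ha => (gi a ha).trans (fi a ha),
      fun a h1 h2 h3 h4 => (gn a h1 h2 h3 h4).trans (fn a h1 h2 h3 h4), ?_, ?_, ?_⟩
    · rw [m7, n7, iter]
      simp [State.tick]
      ring
    · rw [m8, n8, profile]
      simp [State.tick]
      ring
    · simp only [State.tick, Test.cost, IExp.cost, cellI] at ht
      rw [List.length_cons]
      nlinarith

theorem exec_evalCmd {l : List (Fin m × Fin n)} {j : Fin n} (hf : l.length < fuel)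
    {s : State} (h3 : s.idx 3 = l.length) (h5 : s.idx 5 = j) (hs : Stored A b c s l) :
    ∃ s', exec A b fuel evalCmd s = PMF.pure (some s') ∧
      (∀ a, a ≠ 6 → s'.idx a = s.idx a) ∧
      (∀ a, a ≠ 4 → a ≠ 5 → a ≠ 7 → a ≠ 8 → s'.num a = s.num a) ∧
      s'.num 7 = iter A b c l j ∧ s'.num 8 = (profile A l j : ℝ) ∧
      s'.time ≤ s.time + 120 * accessTime m n * (l.length + 1) := by
  have hτ := one_le_accessTime m n
  obtain ⟨s0, e0, i6, i0, n0, n7, n8, ht0⟩ : ∃ s0, exec A b fuel evalCmd s =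
      runLoop (.ltIdx (.const 0) (cellI 6)) (exec A b fuel evalBody) fuel s0 ∧
      s0.idx 6 = l.length ∧ (∀ a, a ≠ 6 → s0.idx a = s.idx a) ∧
      (∀ a, a ≠ 7 → a ≠ 8 → s0.num a = s.num a) ∧ s0.num 7 = 0 ∧ s0.num 8 = 0 ∧
      s0.time = s.time + 12 := by
    refine ⟨_, by simp only [evalCmd, exec, andThen_pure]; rfl, ?_, ?_, ?_, ?_, ?_, ?_⟩
    · simp [State.tick, State.writeIdx, State.writeNum, IExp.eval, cellI, h3]
    · intro a ha
      simp [State.tick, State.writeIdx, State.writeNum, IExp.eval, ha]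
    · intro a h7 h8
      simp [State.tick, State.writeIdx, State.writeNum, IExp.eval, h7, h8]
    · simp [State.tick, State.writeIdx, State.writeNum, IExp.eval, NExp.eval, constN]
    · simp [State.tick, State.writeIdx, State.writeNum, IExp.eval, NExp.eval, constN]
    · simp [State.tick, State.writeIdx, State.writeNum, IExp.cost, NExp.cost, constN, cellI]
  obtain ⟨s', e, fi, fn, m7, m8, ht⟩ := runLoop_evalBody (fuel := fuel) (A := A) (b := b) (c := c)
    (j := j) hf i6 ((i0 5 (by norm_num)).trans h5) (hs.congr (fun a _ => i0 _ (by omega))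
      (fun a _ => n0 _ (by omega) (by omega)))
  refine ⟨s', e0.trans e, fun a ha => (fi a ha).trans (i0 a ha),
    fun a h1 h2 h3 h4 => (fn a h1 h2 h3 h4).trans (n0 a h3 h4),
    m7.trans (by rw [n7, zero_add]), m8.trans (by rw [n8, zero_add]), ht.trans ?_⟩
  rw [ht0]
  clear * - hτ
  generalize accessTime m n = τ at *
  nlinarith

/-- The number cells that hold the parameters of the algorithm have the same content in both
states. -/
def SameParams (s s' : State) : Prop :=
  s'.num 3 = s.num 3 ∧ s'.num 9 = s.num 9 ∧ s'.num 10 = s.num 10 ∧ s'.num 11 = s.num 11 ∧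
    s'.num 12 = s.num 12

theorem SameParams.trans {s s' s'' : State} (h : SameParams s s') (h' : SameParams s' s'') :
    SameParams s s'' :=
  ⟨h'.1.trans h.1, h'.2.1.trans h.2.1, h'.2.2.1.trans h.2.2.1, h'.2.2.2.1.trans h.2.2.2.1,
    h'.2.2.2.2.trans h.2.2.2.2⟩

/-- A step with given row and column, deterministically: the sample is appended to the list. -/
theorem exec_pushCmd {l : List (Fin m × Fin n)} {r : Fin m} {j : Fin n} (hf : l.length < fuel)
    {s : State} (h3 : s.idx 3 = l.length) (h4 : s.idx 4 = r) (h5 : s.idx 5 = j)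
    (h9 : s.num 9 = c) (hs : Stored A b c s l) :
    ∃ s', exec A b fuel pushCmd s = PMF.pure (some s') ∧
      s'.idx 0 = s.idx 0 ∧ s'.idx 3 = l.length + 1 ∧ s'.num 13 = s.num 13 ∧ SameParams s s' ∧
      Stored A b c s' ((r, j) :: l) ∧
      s'.time ≤ s.time + 200 * accessTime m n * (l.length + 1) := by
  have hτ := one_le_accessTime m n
  obtain ⟨s1, e1, fi, fn, n7, -, ht⟩ := exec_evalCmd hf h3 h5 hs
  have i3 := (fi 3 (by norm_num)).trans h3
  have i4 := (fi 4 (by norm_num)).trans h4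
  have i5 := (fi 5 (by norm_num)).trans h5
  have i0 := fi 0 (by norm_num)
  have k (a) (h : a ≠ 4 ∧ a ≠ 5 ∧ a ≠ 7 ∧ a ≠ 8) : s1.num a = s.num a :=
    fn a h.1 h.2.1 h.2.2.1 h.2.2.2
  have k9 := (k 9 (by norm_num)).trans h9
  refine ⟨_, by simp only [pushCmd, exec_seq_of_eq e1]; simp only [exec, andThen_pure]; rfl,
    ?_, ?_, ?_, ?_, ⟨?_, ?_, (hs.congr (s' := s1) (fun a _ => fi _ (by omega))
      (fun a _ => k _ (by omega))).congr (fun a ha => ?_) (fun a ha => ?_)⟩, ?_⟩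
  · simp [State.tick, State.writeIdx, State.writeNum, State.count, IExp.eval, cellI, i3, i0]
  · simp [State.tick, State.writeIdx, State.writeNum, State.count, IExp.eval, cellI, i3]
  · simp [State.tick, State.writeIdx, State.writeNum, State.count, IExp.eval, cellI, i3,
      k]
  · simp [SameParams, State.tick, State.writeIdx, State.writeNum, State.count, IExp.eval, cellI,
      i3, k]
  · simp [State.tick, State.writeIdx, State.writeNum, State.count, IExp.eval, cellI, i3, i4]
  · simp [State.tick, State.writeIdx, State.writeNum, State.count, IExp.eval, NExp.eval, cellI,
      cellN, i3, i4, i5, k9, n7, Query.answer, stepCoef, sq]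
  · simp [State.tick, State.writeIdx, State.writeNum, State.count, IExp.eval, cellI, i3, ha.ne]
  · simp [State.tick, State.writeIdx, State.writeNum, State.count, IExp.eval, cellI, i3, ha.ne]
  · simp only [State.tick, State.writeIdx, State.writeNum, State.count, IExp.cost, NExp.cost,
      Query.cost, cellI, cellN]
    clear * - ht hτ
    generalize accessTime m n = τ at *
    generalize s1.time = t1 at *
    nlinarith

theorem sim_sample_rowA [NeZero m] (a : IExp) (s : State) :
    Sim (exec A b fuel (.sample a .rowA) s) (rowLaw A) fun r s' =>
      s' = ((s.writeIdx (a.eval s) r).tick (a.cost + accessTime m n)).count := by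
  rw [exec, Sample.law, weightedIndex_eq_map, PMF.map_comp]
  exact Sim.map fun r => rfl

theorem sim_sample_inRowA [NeZero n] (a e : IExp) {s : State} {r : Fin m} (he : e.eval s = r) :
    Sim (exec A b fuel (.sample a (.inRowA e)) s) (colLaw A r) fun j s' =>
      s' = ((s.writeIdx (a.eval s) j).tick (a.cost + e.cost + accessTime m n)).count := by
  have h : Sample.law A b s (.inRowA e) = (colLaw A r).map Fin.val := by
    simp [Sample.law, he, weightedIndex_eq_map, colLaw]
  rw [exec, h, PMF.map_comp]
  exact Sim.map fun r => rfl

theorem sim_flip (a : IExp) (p : NExp) {s : State} {x : ℝ} (hx : p.eval s = x) :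
    Sim (exec A b fuel (.flip a p) s) (biasedCoin x) fun v s' =>
      s' = (s.writeIdx (a.eval s) v).tick (a.cost + p.cost + 1) := by
  rw [exec, hx, Complex.ofReal_re]
  exact Sim.map fun r => rfl

/-- The gradient descent loop draws the list of samples and stores it. -/
theorem sim_loop_stepCmd [NeZero m] [NeZero n] {T : ℝ} {N : ℕ} (hN : N = ⌈T⌉₊) (hf : N < fuel)
    (d : ℕ) {l : List (Fin m × Fin n)} {k : ℕ} (hk : d < k) (hd : l.length + d = N) {s : State}
    (h3 : s.idx 3 = l.length) (h9 : s.num 9 = c) (h10 : s.num 10 = T) (hs : Stored A b c s l) :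
    Sim (runLoop (.ltNum (.ofIdx (cellI 3)) (cellN 10)) (exec A b fuel stepCmd) k s)
      (tapeLaw A d l) fun l' s' => l'.length = N ∧ s'.idx 0 = s.idx 0 ∧ s'.idx 3 = N ∧
        s'.num 13 = s.num 13 ∧ SameParams s s' ∧ Stored A b c s' l' ∧
        s'.time ≤ s.time + 300 * accessTime m n * (N + 1) * d + 10 := by
  have hτ := one_le_accessTime m n
  have htest (s : State) (i : ℕ) (h3 : s.idx 3 = i) (h10 : s.num 10 = T) :
      Test.holds s (.ltNum (.ofIdx (cellI 3)) (cellN 10)) ↔ i < N := by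
    rw [hN, Nat.lt_ceil]
    simp [Test.holds, IExp.eval, NExp.eval, cellI, cellN, h3, h10]
  induction d generalizing l k s with
  | zero =>
    rw [runLoop_of_not_holds (by omega) (by rw [htest s _ h3 h10]; omega), tapeLaw]
    refine Sim.pure ⟨by omega, rfl, by rw [← hd]; exact h3, rfl, ⟨rfl, rfl, rfl, rfl, rfl⟩,
      hs.congr (fun _ _ => rfl) (fun _ _ => rfl), ?_⟩
    simp [State.tick, Test.cost, IExp.cost, NExp.cost, cellI, cellN]
  | succ d ih =>
    rw [runLoop_of_holds (by omega) ((htest s _ h3 h10).2 (by omega)), tapeLaw, stepCmd, exec_seq,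
      andThen_assoc]
    refine (sim_sample_rowA _ _).andThen fun r s1 h1 => ?_
    rw [exec_seq, andThen_assoc]
    refine (sim_sample_inRowA _ _ (r := r) (by simp [h1, State.tick, State.writeIdx, State.count,
      IExp.eval, cellI])).andThen fun j s2 h2 => ?_
    have f2 : s2.idx 4 = r ∧ s2.idx 5 = j ∧ s2.idx 0 = s.idx 0 ∧ s2.idx 3 = l.length := by
      simp [h2, h1, State.tick, State.writeIdx, State.count, IExp.eval, h3]
    have fs : ∀ a, s2.idx (a + 8) = s.idx (a + 8) := by
      simp [h2, h1, State.tick, State.writeIdx, State.count, IExp.eval]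
    have fn : s2.num = s.num := by
      simp [h2, h1, State.tick, State.writeIdx, State.count]
    have ft : s2.time ≤ s.time + 30 * accessTime m n := by
      simp only [h2, h1, State.tick, State.writeIdx, State.count, Test.cost, IExp.cost, NExp.cost,
        cellI, cellN]
      omega
    obtain ⟨s3, e3, i0, i3, i13, hp, hst, ht⟩ := exec_pushCmd (fuel := fuel) (A := A) (b := b)
      (c := c) (l := l) (r := r) (j := j) (s := s2) (by omega) f2.2.2.2 f2.1 f2.2.1 (by rw [fn, h9])
      (hs.congr (fun a _ => fs a) (fun a _ => by rw [fn]))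
    rw [e3, andThen_pure]
    have hp' : SameParams s s3 := by
      simpa only [SameParams, fn] using hp
    refine (ih (l := (r, j) :: l) (by omega) (by simp; omega) (by simpa using i3)
      (hp'.2.1.trans h9) (hp'.2.2.1.trans h10) hst).mono ?_
    rintro l' s' ⟨g1, g2, g3, g4, g5, g6, g7⟩
    refine ⟨g1, g2.trans (i0.trans f2.2.2.1), g3, g4.trans (i13.trans (by rw [fn])), hp'.trans g5,
      g6, g7.trans ?_⟩
    have hl : l.length ≤ N := by omega
    clear * - ht ft hl
    generalize accessTime m n = τ at *
    have h1 : τ * (l.length + 1) ≤ τ * (N + 1) := by gcongr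
    have h2 : τ ≤ τ * (N + 1) := Nat.le_mul_of_pos_right _ (by omega)
    nlinarith

/-- The random choice of a stored row. The content of index cell `4` before the loop matters only if
no sample is stored. -/
theorem sim_loop_pickBody {l : List (Fin m × Fin n)} {r : Fin m} {k : ℕ} (hk : l.length < k)
    {s : State} (h6 : s.idx 6 = l.length) (hr : l = [] → s.idx 4 = r) (hs : Stored A b c s l) :
    Sim (runLoop (.ltIdx (.const 0) (cellI 6)) (exec A b fuel pickBody) k s)
      (pickLaw r l) fun r' s' => s'.idx 4 = r' ∧ (∀ a, a ≠ 4 → a ≠ 6 → a ≠ 7 → s'.idx a = s.idx a) ∧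
        s'.num = s.num ∧ s'.time ≤ s.time + 50 * (l.length + 1) := by
  induction l generalizing k s r with
  | nil =>
    rw [runLoop_of_not_holds (by omega) (by simp [Test.holds, IExp.eval, cellI, h6]), pickLaw]
    refine Sim.pure ⟨hr rfl, fun _ _ _ _ => rfl, rfl, ?_⟩
    simp [State.tick, Test.cost, IExp.cost, cellI]
  | cons ω l ih =>
    rw [runLoop_of_holds (by omega) (by simp [Test.holds, IExp.eval, cellI, h6]), pickLaw]
    obtain ⟨h1, h2, h3⟩ := hs
    rw [List.length_cons] at h6 hk
    unfold pickBody
    rw [exec_seq_of_eq rfl, exec_seq_of_eq rfl, exec_seq, andThen_assoc]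
    set s1 : State := _
    refine (sim_flip _ _ (s := s1) (x := 1 / (l.length + 1)) ?_).andThen fun v s2 e2 => ?_
    · simp [s1, State.tick, State.writeIdx, IExp.eval, NExp.eval, cellI, constN, h6]
    have hs1 : s1.idx 4 = ω.1 ∧ s1.idx 6 = l.length := by
      simp [s1, State.tick, State.writeIdx, IExp.eval, cellI, h6, h1]
    have hs1' : ∀ a, a ≠ 4 → a ≠ 6 → s1.idx a = s.idx a := by
      intro a h4 h6
      simp [s1, State.tick, State.writeIdx, IExp.eval, h4, h6]
    have hn1 : s1.num = s.num := rfl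
    have ht1 : s1.time ≤ s.time + 20 := by
      simp [s1, State.tick, State.writeIdx, Test.cost, IExp.cost, cellI]
    have hs2 : s2.idx 4 = ω.1 ∧ s2.idx 6 = l.length ∧ s2.idx 7 = v := by
      simp [e2, State.tick, State.writeIdx, IExp.eval, hs1]
    have hs2' : ∀ a, a ≠ 4 → a ≠ 6 → a ≠ 7 → s2.idx a = s.idx a := by
      intro a h4 h6 h7
      simp [e2, State.tick, State.writeIdx, IExp.eval, h7, hs1' a h4 h6]
    have hn2 : s2.num = s.num := by rw [e2]; exact hn1
    have ht2 : s2.time ≤ s.time + 32 := by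
      simp only [e2, State.tick, State.writeIdx, IExp.cost, NExp.cost, cellI, constN]
      omega
    clear_value s1
    rcases Nat.eq_zero_or_pos v with hv | hv
    · rw [exec, if_neg (by simp [Test.holds, IExp.eval, cellI, hs2, hv]), exec, andThen_pure,
        if_pos hv]
      refine (ih (r := ω.1) (by omega) ?_ ?_ ?_).mono ?_
      · exact hs2.2.1
      · exact fun _ => hs2.1
      · exact h3.congr (fun a _ => hs2' _ (by omega) (by omega) (by omega))
          (fun a _ => congrFun hn2 _)
      · rintro r' s' ⟨g1, g2, g3, g4⟩
        refine ⟨g1, fun a h4 h6 h7 => (g2 a h4 h6 h7).trans (hs2' a h4 h6 h7), g3.trans hn2,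
          g4.trans ?_⟩
        simp only [State.tick, Test.cost, IExp.cost, cellI, List.length_cons]
        omega
    · rw [exec, if_pos (by simp [Test.holds, IExp.eval, cellI, hs2, hv]), exec, andThen_pure,
        if_neg hv.ne', runLoop_of_not_holds (by omega)
          (by simp [Test.holds, IExp.eval, cellI, State.tick, State.writeIdx])]
      refine Sim.pure ⟨?_, ?_, hn2, ?_⟩
      · simp [State.tick, State.writeIdx, IExp.eval, hs2]
      · intro a h4 h6 h7
        simp [State.tick, State.writeIdx, IExp.eval, h6, hs2' a h4 h6 h7]
      · simp only [State.tick, State.writeIdx, Test.cost, IExp.cost, cellI, List.length_cons]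
        omega

end Specs
end RAM

/-! ### An attempt and its repetitions -/

namespace RAM
section Specs
variable {m n : ℕ} {A : Matrix (Fin m) (Fin n) ℂ} {b : Fin m → ℂ} {c : ℝ} {fuel : ℕ}

/-- The rejection step. -/
theorem sim_acceptCmd {L : ℝ} {l : List (Fin m × Fin n)} {j : Fin n} (hf : l.length < fuel)
    {s : State} (h3 : s.idx 3 = l.length) (h5 : s.idx 5 = j) (h11 : s.num 11 = L)
    (hs : Stored A b c s l) :
    Sim (exec A b fuel acceptCmd s)
      ((biasedCoin (‖iter A b c l j‖ ^ 2 / (L * profile A l j))).bind fun v =>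
        PMF.pure (if v = 0 then none else some j)) fun o s' => SameParams s s' ∧
        (o = none → s'.idx 0 = s.idx 0 ∧ s'.num 13 = s.num 13 * (1 - s.num 12)) ∧
        (∀ j : Fin n, o = some j → s'.idx 0 = 1 ∧ s'.idx 1 = j ∧ s'.num 13 = 0) ∧
        s'.time ≤ s.time + 200 * accessTime m n * (l.length + 1) := by
  have hτ := one_le_accessTime m n
  obtain ⟨s1, e1, fi, fn, n7, n8, ht⟩ := exec_evalCmd hf h3 h5 hs
  have k (a) (h : a ≠ 4 ∧ a ≠ 5 ∧ a ≠ 7 ∧ a ≠ 8) : s1.num a = s.num a :=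
    fn a h.1 h.2.1 h.2.2.1 h.2.2.2
  rw [acceptCmd, exec_seq_of_eq e1, exec_seq]
  refine (sim_flip _ _ (s := s1) (x := ‖iter A b c l j‖ ^ 2 / (L * profile A l j)) ?_).andThen
    fun v s2 e2 => ?_
  · simp only [NExp.eval, IExp.eval, cellN, n7, n8, (k 11 (by norm_num)).trans h11,
      Complex.mul_conj']
    push_cast
    rfl
  have hi7 : s2.idx 7 = v := by simp [e2, State.tick, State.writeIdx, IExp.eval]
  have hi (a) (h6 : a ≠ 6) (h7 : a ≠ 7) : s2.idx a = s.idx a := by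
    rw [← fi a h6]
    simp [e2, State.tick, State.writeIdx, IExp.eval, h7]
  have hn : s2.num = s1.num := by rw [e2]; rfl
  have ht2 : s2.time ≤ s.time + 150 * accessTime m n * (l.length + 1) := by
    simp only [e2, State.tick, State.writeIdx, IExp.cost, NExp.cost, cellN]
    clear * - ht hτ
    generalize accessTime m n = τ at *
    generalize s1.time = t1 at *
    nlinarith
  have hlin : 30 ≤ 50 * accessTime m n * (l.length + 1) := by
    clear * - hτ
    generalize accessTime m n = τ at *
    nlinarith
  rcases Nat.eq_zero_or_pos v with hv | hv
  · rw [exec, if_neg (by simp [Test.holds, IExp.eval, cellI, hi7, hv]), exec, if_pos hv]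
    refine Sim.pure ⟨?_, fun _ => ⟨?_, ?_⟩, by simp, ?_⟩
    · simp [SameParams, State.tick, State.writeNum, IExp.eval, hn, k]
    · simp [State.tick, State.writeNum, hi]
    · simp [State.tick, State.writeNum, IExp.eval, NExp.eval, cellN, constN, hn, k]
    · simp only [State.tick, State.writeNum, Test.cost, IExp.cost, NExp.cost, cellI, cellN, constN]
      clear * - ht2 hlin
      generalize accessTime m n = τ at *
      nlinarith
  · rw [exec, if_pos (by simp [Test.holds, IExp.eval, cellI, hi7, hv]), if_neg hv.ne']
    simp only [exec, andThen_pure]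
    refine Sim.pure ⟨?_, by simp, fun j' hj' => ⟨?_, ?_, ?_⟩, ?_⟩
    · simp [SameParams, State.tick, State.writeIdx, State.writeNum, IExp.eval, hn, k]
    · simp [State.tick, State.writeIdx, State.writeNum, IExp.eval]
    · obtain rfl := Option.some.inj hj'
      simp [State.tick, State.writeIdx, State.writeNum, IExp.eval, cellI, hi, h5]
    · simp [State.tick, State.writeIdx, State.writeNum, IExp.eval, NExp.eval, constN]
    · simp only [State.tick, State.writeIdx, State.writeNum, Test.cost, IExp.cost, NExp.cost,
        cellI, constN]
      clear * - ht2 hlin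
      generalize accessTime m n = τ at *
      nlinarith

variable [NeZero m] [NeZero n]

/-- An attempt has the law `attemptLaw`; it leaves a success in index cells `0` and `1`, and it
updates the bound in number cell `13`. -/
theorem sim_attemptCmd {T L : ℝ} {N : ℕ} (hN : N = ⌈T⌉₊) (hN0 : 0 < N) (hf : N < fuel)
    {s : State} (h9 : s.num 9 = c) (h10 : s.num 10 = T) (h11 : s.num 11 = L) :
    Sim (exec A b fuel attemptCmd s) (attemptLaw A b c L N) fun o s' => SameParams s s' ∧
        (o = none → s'.idx 0 = s.idx 0 ∧ s'.num 13 = s.num 13 * (1 - s.num 12)) ∧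
        (∀ j : Fin n, o = some j → s'.idx 0 = 1 ∧ s'.idx 1 = j ∧ s'.num 13 = 0) ∧
        s'.time ≤ s.time + 1000 * accessTime m n * (N + 1) ^ 2 := by
  have hτ := one_le_accessTime m n
  rw [attemptCmd, exec_seq_of_eq rfl, exec_seq, exec]
  have h0 := sim_loop_stepCmd (A := A) (b := b) (c := c) (fuel := fuel) hN hf N (l := []) hf
    (by simp) (s := (s.writeIdx 3 0).tick 3) (by simp [State.tick, State.writeIdx]) h9 h10 trivial
  refine h0.andThen ?_
  rintro l s1 ⟨hl, i0, i3, n13, hp1, hs1, ht1⟩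
  have i0' : s1.idx 0 = s.idx 0 := i0.trans (by simp [State.tick, State.writeIdx])
  rw [exec_seq_of_eq rfl, exec_seq, exec]
  set s2 : State := (s1.writeIdx 6 (s1.idx 3)).tick 4 with hs2
  refine Sim.andThen (ρ := pickLaw 0 l) (sim_loop_pickBody (s := s2) (A := A) (b := b) (c := c)
    (by omega) (by simp [hs2, State.tick, State.writeIdx, i3, hl])
    (fun h => by simp [h] at hl; omega) (hs1.congr ?_ fun _ _ => rfl)) ?_
  · intro a _
    simp [hs2, State.tick, State.writeIdx]
  rintro r s3 ⟨i4, fi3, fn3, ht3⟩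
  rw [exec_seq]
  refine (sim_sample_inRowA (.const 5) (cellI 4) (s := s3) (r := r)
    (by simp [IExp.eval, cellI, i4])).andThen fun j s4 e4 => ?_
  have fi4 (a) (h4 : a ≠ 4) (h5 : a ≠ 5) (h6 : a ≠ 6) (h7 : a ≠ 7) : s4.idx a = s1.idx a := by
    have h1 : s4.idx a = s3.idx a := by
      simp [e4, State.tick, State.writeIdx, State.count, IExp.eval, h5]
    rw [h1, fi3 a h4 h6 h7]
    simp [hs2, State.tick, State.writeIdx, h6]
  have fn4 : s4.num = s1.num := by
    rw [e4]; exact fn3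
  refine (sim_acceptCmd (A := A) (b := b) (c := c) (L := L) (l := l) (j := j) (s := s4) (by omega)
    ?_ ?_ ?_ ?_).mono ?_
  · rw [fi4 3 (by norm_num) (by norm_num) (by norm_num) (by norm_num), i3, hl]
  · simp [e4, State.tick, State.writeIdx, State.count, IExp.eval]
  · rw [fn4]; exact hp1.2.2.2.1.trans h11
  · exact hs1.congr (fun a _ => fi4 _ (by omega) (by omega) (by omega) (by omega))
      fun a _ => by rw [fn4]
  · rintro o s' ⟨g1, g2, g3, g4⟩
    refine ⟨hp1.trans (by simpa only [SameParams, fn4] using g1), fun ho => ?_, g3, ?_⟩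
    · obtain ⟨k1, k2⟩ := g2 ho
      rw [fn4] at k2
      exact ⟨k1.trans ((fi4 0 (by norm_num) (by norm_num) (by norm_num) (by norm_num)).trans i0'),
        k2.trans (by rw [n13, hp1.2.2.2.2]; rfl)⟩
    · have ht4 : s4.time ≤ s3.time + 4 * accessTime m n := by
        simp only [e4, State.tick, State.writeIdx, State.count, IExp.cost, cellI]
        omega
      have ht2 : s2.time = s1.time + 4 := rfl
      have ht0 : ((s.writeIdx 3 0).tick 3).time = s.time + 3 := rfl
      rw [hl] at g4 ht3
      clear * - g4 ht4 ht3 ht2 ht1 ht0 hτ hN0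
      generalize accessTime m n = τ at *
      have e1 : 300 * τ * (N + 1) * N ≤ 300 * τ * (N + 1) ^ 2 := by nlinarith
      have e2 : τ * (N + 1) ≤ τ * (N + 1) ^ 2 := by nlinarith
      have e3 : N + 1 ≤ τ * (N + 1) := Nat.le_mul_of_pos_left _ hτ
      have e4 : τ ≤ τ * (N + 1) := Nat.le_mul_of_pos_right _ (by omega)
      nlinarith

/-- Attempts are repeated while the bound `w = (1 - q) ^ i` on the probability of `i` failures
exceeds `δ`. -/
theorem sim_loop_attemptCmd {T L δ q : ℝ} {N D : ℕ} (hN : N = ⌈T⌉₊) (hN0 : 0 < N) (hf : N < fuel)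
    (hδ : 0 < δ) (hD : ∀ i < D, δ < (1 - q) ^ i) (hD' : (1 - q) ^ D ≤ δ)
    (d : ℕ) {i k : ℕ} (hd : i + d = D) (hk : d < k)
    {s : State} (h3 : s.num 3 = δ) (h9 : s.num 9 = c) (h10 : s.num 10 = T) (h11 : s.num 11 = L)
    (h12 : s.num 12 = q) (h13 : s.num 13 = ((1 - q) ^ i : ℝ)) (h0 : s.idx 0 = 0) :
    Sim (runLoop (.ltNum (cellN 3) (cellN 13)) (exec A b fuel attemptCmd) k s)
      (repeatLaw (attemptLaw A b c L N) d) fun o s' => output n s' = o ∧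
        s'.time ≤ s.time + 1010 * accessTime m n * (N + 1) ^ 2 * d + 10 := by
  have hτ := one_le_accessTime m n
  induction d generalizing i k s with
  | zero =>
    rw [runLoop_of_not_holds (by omega), repeatLaw]
    · refine Sim.pure ⟨?_, ?_⟩
      · rw [output, dif_neg]
        simp [State.tick, h0]
      · simp [State.tick, Test.cost, IExp.cost, NExp.cost, cellN]
    · have : i = D := by omega
      simp only [Test.holds, NExp.eval, IExp.eval, cellN, h3, h13, Complex.ofReal_re, not_lt, this]
      exact hD'
  | succ d ih =>
    rw [runLoop_of_holds (by omega), repeatLaw]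
    · refine (sim_attemptCmd (A := A) (b := b) (c := c) (T := T) (L := L)
        (s := s.tick (Test.cost (.ltNum (cellN 3) (cellN 13)))) hN hN0 hf h9 h10 h11).andThen ?_
      rintro o s1 ⟨hp, hnone, hsome, ht⟩
      have ht' : s1.time ≤ s.time + 1005 * accessTime m n * (N + 1) ^ 2 := by
        simp only [State.tick, Test.cost, IExp.cost, NExp.cost, cellN] at ht
        clear * - ht hτ hN0
        generalize accessTime m n = τ at *
        have : 1 ≤ τ * (N + 1) ^ 2 := Nat.one_le_iff_ne_zero.2 (by positivity)
        nlinarith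
      cases o with
      | none =>
        obtain ⟨k1, k2⟩ := hnone rfl
        refine (ih (i := i + 1) (k := k - 1) (s := s1) (by omega) (by omega) (hp.1.trans h3)
          (hp.2.1.trans h9) (hp.2.2.1.trans h10) (hp.2.2.2.1.trans h11) (hp.2.2.2.2.trans h12)
          (k2.trans ?_) (k1.trans h0)).mono ?_
        · change s.num 13 * (1 - s.num 12) = _
          rw [h13, h12]
          push_cast
          ring
        · rintro o s' ⟨g1, g2⟩
          refine ⟨g1, g2.trans ?_⟩
          clear * - ht'
          generalize accessTime m n = τ at *
          nlinarith
      | some j =>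
        obtain ⟨k1, k2, k3⟩ := hsome j rfl
        rw [runLoop_of_not_holds (by omega)]
        · refine Sim.pure ⟨?_, ?_⟩
          · rw [output, dif_pos ⟨by simp [State.tick, k1], by simp [State.tick, k2]⟩]
            simp [State.tick, k2]
          · simp only [State.tick, Test.cost, IExp.cost, NExp.cost, cellN]
            clear * - ht'
            generalize accessTime m n = τ at *
            have : 0 ≤ τ * (N + 1) ^ 2 * d := Nat.zero_le _
            nlinarith
        · simp only [Test.holds, NExp.eval, IExp.eval, cellN, k3, hp.1.trans h3,
            Complex.ofReal_re, Complex.zero_re]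
          exact not_lt.2 hδ.le
    · simp only [Test.holds, NExp.eval, IExp.eval, cellN, h3, h13, Complex.ofReal_re]
      exact hD i (by omega)

end Specs
end RAM

/-! ### Parameters, total variation and running time -/

namespace RAM

/-- Compute the parameters of the algorithm: the accuracy `u` in number cell `6`, `rank · κ²` in
`7`, `1 / γ²` in `8`, the step size in `9`, the number of steps in `10`, the rejection constant in
`11`, a lower bound on the success probability of an attempt in `12`. -/
def setupCmd : Cmd :=
  .seq (.query (.const 4) .frobNormA) <|
  .seq (.query (.const 5) .normB) <|
  .seq (.setNum (.const 6)
    (.div (cellN 2) (.mul (constN 2) (.add (constN 1) (cellN 2))))) <|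
  .seq (.setNum (.const 7) (.mul (.ofIdx (cellI 2)) (.mul (cellN 0) (cellN 0)))) <|
  .seq (.setNum (.const 8) (.div (constN 1) (.mul (cellN 1) (cellN 1)))) <|
  .seq (.setNum (.const 9) (.div (.mul (cellN 6) (cellN 6))
    (.mul (.mul (constN 192) (cellN 8)) (cellN 7)))) <|
  .seq (.setNum (.const 10) (.div (.mul (.mul (constN 6144) (cellN 8)) (.mul (cellN 7) (cellN 7)))
    (.mul (.mul (cellN 6) (cellN 6)) (.mul (cellN 6) (cellN 6))))) <|
  .seq (.setNum (.const 11) (.div (.mul (.mul (constN 20) (cellN 7)) (.mul (cellN 5) (cellN 5)))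
    (.mul (.mul (cellN 4) (cellN 4)) (cellN 6)))) <|
  .seq (.setNum (.const 12) (.div (cellN 6)
    (.mul (.mul (.mul (constN 80) (cellN 8)) (cellN 7)) (cellN 10)))) <|
  .seq (.setNum (.const 13) (constN 1)) <|
  .setIdx (.const 0) (.const 0)

/-- The algorithm. -/
def solver : Cmd := .seq setupCmd (.loop (.ltNum (cellN 3) (cellN 13)) attemptCmd)

theorem exec_setupCmd {m n : ℕ} (A : Matrix (Fin m) (Fin n) ℂ) (b : Fin m → ℂ) (fuel k : ℕ)
    (κ γ ε δ : ℝ) {u K θ c T L q : ℝ} (hu : u = ε / (2 * (1 + ε))) (hK : K = k * κ ^ 2)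
    (hθ : θ = 1 / γ ^ 2) (hc : c = u ^ 2 / (192 * θ * K)) (hT : T = 6144 * θ * K ^ 2 / u ^ 4)
    (hL : L = 20 * K * l2norm b ^ 2 / (frobNorm A ^ 2 * u)) (hq : q = u / (80 * θ * K * T)) :
    ∃ s, exec A b fuel setupCmd (start m n k κ γ ε δ) = PMF.pure (some s) ∧ s.idx 0 = 0 ∧
      s.num 3 = δ ∧ s.num 9 = c ∧ s.num 10 = T ∧ s.num 11 = L ∧ s.num 12 = q ∧ s.num 13 = 1 ∧
      s.time ≤ 200 * accessTime m n := by
  have hτ := one_le_accessTime m n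
  have h6 : (ε / (2 * (1 + ε)) : ℂ) = u := by rw [hu]; push_cast; ring
  have h7 : (k * (κ * κ) : ℂ) = K := by rw [hK]; push_cast; ring
  have h8 : ((γ : ℂ)⁻¹ * (γ : ℂ)⁻¹ : ℂ) = θ := by rw [hθ]; push_cast; rw [one_div, sq, mul_inv]
  have h9 : (u * u / (192 * θ * K) : ℂ) = c := by rw [hc]; push_cast; ring
  have h10 : (6144 * θ * (K * K) / (u * u * (u * u)) : ℂ) = T := by rw [hT]; push_cast; ring
  have h11 : (20 * K * (l2norm b * l2norm b) / (frobNorm A * frobNorm A * u) : ℂ) = L := by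
    rw [hL]; push_cast; ring
  have h12 : (u / (80 * θ * K * T) : ℂ) = q := by rw [hq]; push_cast; ring
  refine ⟨_, by simp only [setupCmd, exec, andThen_pure]; rfl, ?_, ?_, ?_, ?_, ?_, ?_, ?_, ?_⟩
  · simp [State.tick, State.writeIdx, State.writeNum, State.count, IExp.eval]
  · simp [State.tick, State.writeIdx, State.writeNum, State.count, IExp.eval, start]
  · simp [State.tick, State.writeIdx, State.writeNum, State.count, IExp.eval, start, NExp.eval,
      Query.answer, cellN, cellI, constN, h6, h7, h8, h9]
  · simp [State.tick, State.writeIdx, State.writeNum, State.count, IExp.eval, start, NExp.eval,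
      Query.answer, cellN, cellI, constN, h6, h7, h8, h10]
  · simp [State.tick, State.writeIdx, State.writeNum, State.count, IExp.eval, start, NExp.eval,
      Query.answer, cellN, cellI, constN, h6, h7, h11]
  · simp [State.tick, State.writeIdx, State.writeNum, State.count, IExp.eval, start, NExp.eval,
      Query.answer, cellN, cellI, constN, h6, h7, h8, h10, h12]
  · simp [State.tick, State.writeIdx, State.writeNum, State.count, IExp.eval, NExp.eval, constN]
  · simp only [State.tick, State.writeIdx, State.writeNum, State.count, IExp.cost, NExp.cost,
      Query.cost, cellI, cellN, constN, start]
    omega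

end RAM

/-- Normalizing weights that are off by the fraction `u` in total yields total variation distance at
most `u`: the change of the normalization costs as much as the change of the weights. -/
theorem tvDist_normalized_le {d : ℕ} {w a : Fin d → ℝ} {u : ℝ} (hw : ∀ j, 0 ≤ w j)
    (hW : 0 < ∑ j, w j) (hX : 0 < ∑ j, a j) (h : ∑ j, |w j - a j| ≤ u * ∑ j, a j) :
    tvDist (fun j => w j / ∑ j, w j) (fun j => a j / ∑ j, a j) ≤ u := by
  set W := ∑ j, w j with hWdef
  set X := ∑ j, a j with hXdef
  have h1 (j : Fin d) : |w j / W - a j / X| ≤ |w j - a j| / X + w j * |1 / W - 1 / X| := by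
    have e : w j / W - a j / X = (w j - a j) / X + w j * (1 / W - 1 / X) := by ring
    rw [e]
    refine (abs_add_le _ _).trans_eq ?_
    rw [abs_div, abs_mul, abs_of_pos hX, abs_of_nonneg (hw j)]
  have h2 : |1 / W - 1 / X| = |W - X| / (W * X) := by
    rw [div_sub_div _ _ hW.ne' hX.ne', abs_div, abs_of_pos (mul_pos hW hX), abs_sub_comm]
    simp
  have h3 : |W - X| ≤ ∑ j, |w j - a j| := by
    rw [hWdef, hXdef, ← Finset.sum_sub_distrib]
    exact Finset.abs_sum_le_sum_abs _ _
  have h4 : ∑ j, |w j / W - a j / X| ≤ 2 * u := by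
    refine (Finset.sum_le_sum fun j _ => h1 j).trans ?_
    rw [Finset.sum_add_distrib, ← Finset.sum_div, ← Finset.sum_mul, ← hWdef, h2]
    have e : W * (|W - X| / (W * X)) = |W - X| / X := by field_simp
    rw [e, ← add_div, div_le_iff₀ hX]
    linarith
  rw [tvDist]
  linarith

theorem natCast_accessTime_le {m n : ℕ} (hm : 0 < m) (hn : 0 < n) :
    (RAM.accessTime m n : ℝ) ≤ (2 * (Real.log m + Real.log n) + 1) ^ 2 := by
  have hmn : m * n ≠ 0 := (Nat.mul_pos hm hn).ne'
  have h1 : (Nat.log 2 (m * n) : ℝ) ≤ 2 * (Real.log m + Real.log n) := by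
    have h2 : ((2 : ℝ) ^ Nat.log 2 (m * n)) ≤ m * n := by
      exact_mod_cast Nat.pow_log_le_self 2 hmn
    have h3 := Real.log_le_log (by positivity) h2
    rw [Real.log_pow, Real.log_mul (by positivity) (by positivity)] at h3
    have h4 := Real.log_two_gt_d9
    have h5 : (0 : ℝ) ≤ Nat.log 2 (m * n) := by positivity
    nlinarith
  rw [RAM.accessTime]
  push_cast
  gcongr

/-- A geometric sequence reaches `δ` after about `log (1 / δ) / q` terms. -/
theorem exists_first_pow_le {q δ : ℝ} (hq : 0 < q) (hq1 : q ≤ 1 / 2) (hδ : 0 < δ) (hδ1 : δ < 1) :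
    ∃ D : ℕ, (∀ i < D, δ < (1 - q) ^ i) ∧ (1 - q) ^ D ≤ δ ∧ 0 < D ∧
      (D : ℝ) + 1 ≤ 4 / q * Real.log (2 / δ) := by
  classical
  have hex : ∃ i : ℕ, (1 - q) ^ i ≤ δ := by
    obtain ⟨i, hi⟩ := exists_pow_lt_of_lt_one hδ (show 1 - q < 1 by linarith)
    exact ⟨i, hi.le⟩
  have hlt : ∀ i < Nat.find hex, δ < (1 - q) ^ i := fun i hi => not_le.1 (Nat.find_min hex hi)
  have hpos : 0 < Nat.find hex := by
    rw [Nat.find_pos]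
    simpa using hδ1
  refine ⟨Nat.find hex, hlt, Nat.find_spec hex, hpos, ?_⟩
  have h1 := hlt (Nat.find hex - 1) (by omega)
  have h2 := Real.log_le_log hδ h1.le
  rw [Real.log_pow] at h2
  have h3 : Real.log (1 - q) ≤ -q := by
    have := Real.log_le_sub_one_of_pos (show 0 < 1 - q by linarith)
    linarith
  have h4 : ((Nat.find hex - 1 : ℕ) : ℝ) = Nat.find hex - 1 := by
    rw [Nat.cast_sub hpos]; simp
  have h5 : 0 ≤ (Nat.find hex : ℝ) - 1 := by rw [← h4]; positivity
  rw [h4] at h2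
  rw [Real.log_div (by norm_num) hδ.ne', div_mul_eq_mul_div, le_div_iff₀ hq]
  have h6 := Real.log_two_gt_d9
  have h7 : Real.log δ < 0 := Real.log_neg hδ hδ1
  nlinarith

/-! ### The algorithm solves the problem -/

/-- The law of the first success among `D` attempts is as close to `𝒟` of the solution as the
expected output weights are to the squared moduli of the solution. -/
theorem repeatLaw_attemptLaw_spec {m n : ℕ} [NeZero m] [NeZero n] {A : Matrix (Fin m) (Fin n) ℂ}
    {b : Fin m → ℂ} {c L q u δ : ℝ} {N D : ℕ} {x : Fin n → ℂ} (hA : A ≠ 0) (hL : 0 < L) (hN : 0 < N)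
    (hx : 0 < l2norm x ^ 2) (hu : u ≤ 1 / 2)
    (hw : ∑ j, |tapeExp A N (fun l => cutWeight A b c L l j) [] - ‖x j‖ ^ 2| ≤ u * l2norm x ^ 2)
    (hqx : q * (N * L) ≤ l2norm x ^ 2 / 2) (hD : (1 - q) ^ D ≤ δ) (hD0 : 0 < D) :
    1 - δ ≤ RAM.successProb (repeatLaw (attemptLaw A b c L N) D) ∧
      tvDist (RAM.successLaw (repeatLaw (attemptLaw A b c L N) D)) (sqDist x) ≤ u := by
  set ν := attemptLaw A b c L N with hν
  set w : Fin n → ℝ := fun j => tapeExp A N (fun l => cutWeight A b c L l j) [] with hwdef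
  have hNL : 0 < N * L := by positivity
  have hνw (j : Fin n) : (ν (some j)).toReal = w j / (N * L) :=
    toReal_attemptLaw_some b c hA hL hN j
  have hw0 (j : Fin n) : 0 ≤ w j := by
    have : 0 ≤ w j / (N * L) := by rw [← hνw]; exact ENNReal.toReal_nonneg
    rwa [le_div_iff₀ hNL, zero_mul] at this
  have hX : l2norm x ^ 2 = ∑ j, ‖x j‖ ^ 2 := l2norm_sq x
  have hW : l2norm x ^ 2 / 2 ≤ ∑ j, w j := by
    have h1 : ∑ j, ‖x j‖ ^ 2 - ∑ j, w j ≤ ∑ j, |w j - ‖x j‖ ^ 2| := by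
      rw [← Finset.sum_sub_distrib]
      refine Finset.sum_le_sum fun j _ => ?_
      rw [abs_sub_comm]
      exact le_abs_self _
    rw [← hX] at h1
    have h2 : u * l2norm x ^ 2 ≤ 1 / 2 * l2norm x ^ 2 := by gcongr
    linarith
  have hW0 : 0 < ∑ j, w j := by linarith
  have hP : RAM.successProb ν = (∑ j, w j) / (N * L) := by
    rw [RAM.successProb, Finset.sum_div]
    exact Finset.sum_congr rfl fun j _ => hνw j
  have hPq : q ≤ RAM.successProb ν := by
    rw [hP, le_div_iff₀ hNL]
    linarith
  have hf := toReal_apply_none ν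
  have hf0 : 0 ≤ (ν none).toReal := ENNReal.toReal_nonneg
  have hsum : RAM.successProb (repeatLaw ν D) = 1 - (ν none).toReal ^ D := by
    rw [successProb_repeatLaw, ← mul_neg_geom_sum, hf]
    ring
  constructor
  · rw [hsum]
    have : (ν none).toReal ^ D ≤ (1 - q) ^ D := by gcongr; linarith
    linarith
  · have hG : 0 < ∑ i ∈ Finset.range D, (ν none).toReal ^ i := by
      refine Finset.sum_pos' (fun i _ => pow_nonneg hf0 i) ⟨0, by simpa using hD0, by simp⟩
    have hlaw : RAM.successLaw (repeatLaw ν D) = fun j => w j / ∑ j, w j := by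
      funext j
      rw [RAM.successLaw, successProb_repeatLaw, toReal_repeatLaw_some, hνw, hP]
      field_simp
    have hsq : sqDist x = fun j => ‖x j‖ ^ 2 / ∑ j, ‖x j‖ ^ 2 := by
      funext j
      rw [sqDist, hX]
    rw [hlaw, hsq]
    exact tvDist_normalized_le hw0 hW0 (by rw [← hX]; exact hx) (by rw [← hX]; exact hw)

/-- The law of the output of the algorithm, and its running time in terms of the numbers `N` of steps
and `D` of attempts. -/
theorem RAM.sim_solver {m n : ℕ} [NeZero m] [NeZero n] {A : Matrix (Fin m) (Fin n) ℂ}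
    {b : Fin m → ℂ} {k N D : ℕ} (κ γ ε : ℝ) {δ u K θ c T L q : ℝ}
    (hu : u = ε / (2 * (1 + ε))) (hK : K = k * κ ^ 2)
    (hθ : θ = 1 / γ ^ 2) (hc : c = u ^ 2 / (192 * θ * K)) (hT : T = 6144 * θ * K ^ 2 / u ^ 4)
    (hL : L = 20 * K * l2norm b ^ 2 / (frobNorm A ^ 2 * u)) (hq : q = u / (80 * θ * K * T))
    (hδ : 0 < δ) (hN : N = ⌈T⌉₊) (hN0 : 0 < N)
    (hD : ∀ i < D, δ < (1 - q) ^ i) (hD' : (1 - q) ^ D ≤ δ) :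
    ∃ μ : PMF State, Terminates A b solver (start m n k κ γ ε δ) μ ∧
      μ.map (output n) = repeatLaw (attemptLaw A b c L N) D ∧
      ∀ s ∈ μ.support, s.queries ≤ s.time ∧
        s.time ≤ 1010 * accessTime m n * (N + 1) ^ 2 * (D + 1) := by
  obtain ⟨s0, e0, i0, n3, n9, n10, n11, n12, n13, ht0⟩ :=
    exec_setupCmd A b (N + D + 1) k κ γ ε δ hu hK hθ hc hT hL hq
  obtain ⟨κ', h1, h2, h3⟩ := sim_loop_attemptCmd (A := A) (b := b) (fuel := N + D + 1)
    hN hN0 (by omega) hδ hD hD' D (i := 0) (by omega) (show D < N + D + 1 by omega) n3 n9 n10 n11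
    n12 (by rw [n13]; simp) i0
  have hexec : exec A b (N + D + 1) solver (start m n k κ γ ε δ) =
      κ'.map (fun p => some p.2) := by
    rw [solver, exec_seq_of_eq e0, exec]
    exact h2
  refine ⟨κ'.map Prod.snd, ⟨N + D + 1, ?_⟩, ?_, ?_⟩
  · rw [hexec, PMF.map_comp]
    rfl
  · rw [← h1, PMF.map_comp, PMF.map, PMF.map]
    ext o
    simp only [PMF.bind_apply]
    refine tsum_congr fun p => ?_
    by_cases hp : p ∈ κ'.support
    · simp [Function.comp, (h3 p hp).1]
    · rw [(κ'.apply_eq_zero_iff p).2 hp, zero_mul, zero_mul]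
  · intro s hs
    obtain ⟨p, hp, rfl⟩ := (PMF.mem_support_map_iff _ _ _).1 hs
    refine ⟨?_, ?_⟩
    · refine queries_le_time_of_mem_support_exec (A := A) (b := b) (fuel := N + D + 1) solver
        (s := start m n k κ γ ε δ) le_rfl ?_
      rw [hexec]
      exact (PMF.mem_support_map_iff _ _ _).2 ⟨p, hp, rfl⟩
    · have hτ := one_le_accessTime m n
      have ht := (h3 p hp).2
      clear * - ht ht0 hτ hN0
      generalize accessTime m n = τ at *
      have h1 : τ ≤ τ * (N + 1) ^ 2 := Nat.le_mul_of_pos_right _ (by positivity)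
      nlinarith

open MvPolynomial in
/-- The polynomial factor of the running time in `k, κ, ‖A‖_F, 1/ε, 1/γ`. The number of
steps is invariant under scaling of `A`, so `‖A‖_F` does not occur; `v` stands for
`1 / u = 2 (1 / ε + 1)`. -/
noncomputable def costPoly : MvPolynomial (Fin 5) ℝ :=
  let K := X 0 * X 1 ^ 2
  let θ := X 4 ^ 2
  let v := 2 * (X 3 + 1)
  C 1292800 * (C 6144 * θ * K ^ 2 * v ^ 4) ^ 3 * θ * K * v

open MvPolynomial in
/-- The polylogarithmic factor of the running time, in `log m, log n`. -/
noncomputable def costPolylog : MvPolynomial (Fin 2) ℝ := (2 * (X 0 + X 1) + 1) ^ 2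

theorem theorem2 :
    ∃ (prog : RAM.Cmd) (P : MvPolynomial (Fin 5) ℝ) (Q : MvPolynomial (Fin 2) ℝ),
      ∀ (m n : ℕ) (A : Matrix (Fin m) (Fin n) ℂ) (b : Fin m → ℂ) (γ ε δ : ℝ),
        b ≠ 0 → 0 < γ → γ * l2norm b ≤ l2norm (A.mulVec ((pinv A).mulVec b)) →
        0 < ε → 0 < δ → δ < 1 →
        ∃ μ : PMF RAM.State,
          RAM.Terminates A b prog (RAM.start m n A.rank (condNumber A) γ ε δ) μ ∧
          (∀ s ∈ μ.support,
            let bound : ℝ :=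
              MvPolynomial.eval ![(A.rank : ℝ), condNumber A, frobNorm A, 1 / ε, 1 / γ] P *
                MvPolynomial.eval ![Real.log m, Real.log n] Q * Real.log (2 / δ)
            (s.queries : ℝ) ≤ bound ∧ (s.time : ℝ) ≤ bound) ∧
          1 - δ ≤ RAM.successProb (μ.map (RAM.output n)) ∧
          tvDist (RAM.successLaw (μ.map (RAM.output n))) (sqDist ((pinv A).mulVec b)) ≤ ε := by
  refine ⟨RAM.solver, costPoly, costPolylog, ?_⟩
  intro m n A b γ ε δ hb hγ hγb hε hδ hδ1
  have hb0 : 0 < l2norm b := (l2norm_nonneg b).lt_of_ne' (mt l2norm_eq_zero.1 hb)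
  have hm : m ≠ 0 := by rintro rfl; exact hb (Subsingleton.elim _ _)
  have hA : A ≠ 0 := by
    rintro rfl
    rw [Matrix.zero_mulVec, l2norm_eq_zero.2 rfl] at hγb
    exact (mul_pos hγ hb0).not_ge hγb
  have hn : n ≠ 0 := by rintro rfl; exact hA (Subsingleton.elim _ _)
  have : NeZero m := ⟨hm⟩
  have : NeZero n := ⟨hn⟩
  set k := A.rank
  set κ := condNumber A
  set F := frobNorm A
  set xs := pinv A *ᵥ b with hxs
  have hF : 0 < F := frobNorm_pos hA
  -- the parameters, which the program computes from its input and two queries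
  obtain ⟨K, hK⟩ : ∃ K, K = (k : ℝ) * κ ^ 2 := ⟨_, rfl⟩
  obtain ⟨θ, hθ⟩ : ∃ θ, θ = 1 / γ ^ 2 := ⟨_, rfl⟩
  obtain ⟨u, hu⟩ : ∃ u, u = ε / (2 * (1 + ε)) := ⟨_, rfl⟩
  obtain ⟨c, hc⟩ : ∃ c, c = u ^ 2 / (192 * θ * K) := ⟨_, rfl⟩
  obtain ⟨T, hT⟩ : ∃ T, T = 6144 * θ * K ^ 2 / u ^ 4 := ⟨_, rfl⟩
  obtain ⟨L, hL⟩ : ∃ L, L = 20 * K * l2norm b ^ 2 / (F ^ 2 * u) := ⟨_, rfl⟩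
  obtain ⟨q, hq⟩ : ∃ q, q = u / (80 * θ * K * T) := ⟨_, rfl⟩
  have hu0 : 0 < u := by rw [hu]; positivity
  have hu1 : u ≤ 1 / 2 := by
    rw [hu, div_le_div_iff₀ (by positivity) (by norm_num)]; linarith
  have huε : u ≤ ε := by
    rw [hu, div_le_iff₀ (by positivity)]; nlinarith
  have hproj : l2norm (A *ᵥ xs) ≤ l2norm b := l2norm_mulVec_pinv_le A b
  have hγ1 : γ ≤ 1 := by
    by_contra! h
    nlinarith
  have hθ1 : 1 ≤ θ := by
    rw [hθ, le_div_iff₀ (by positivity), one_mul]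
    exact pow_le_one₀ hγ.le hγ1
  have hgap (w : Fin m → ℂ) : F ^ 2 * l2norm (Aᴴ *ᵥ w) ^ 2 ≤
      K * l2norm (A *ᵥ (Aᴴ *ᵥ w)) ^ 2 := by
    rw [hK]; exact frobNorm_sq_mul_le A w
  have hgapx : F ^ 2 * l2norm xs ^ 2 ≤ K * l2norm (A *ᵥ xs) ^ 2 := by
    obtain ⟨w, hw⟩ := pinv_mulVec_mem_rowSpace A b
    rw [hxs, hw]
    exact hgap w
  have hAx : l2norm (A *ᵥ xs) ^ 2 ≤ F ^ 2 * l2norm xs ^ 2 := l2norm_mulVec_le A xs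
  -- the threshold `γ` bounds the noise, which is proportional to `‖b‖²`, in terms of the solution
  have hbx : l2norm b ^ 2 ≤ θ * F ^ 2 * l2norm xs ^ 2 := by
    have h1 : (γ * l2norm b) ^ 2 ≤ F ^ 2 * l2norm xs ^ 2 := by
      refine le_trans ?_ hAx
      gcongr
    calc l2norm b ^ 2 = θ * (γ * l2norm b) ^ 2 := by rw [hθ]; field_simp
      _ ≤ θ * (F ^ 2 * l2norm xs ^ 2) := by gcongr
      _ = _ := by ring
  have hX : 0 < l2norm xs ^ 2 := by
    by_contra! h
    have h1 : l2norm xs ^ 2 = 0 := le_antisymm h (by positivity)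
    rw [h1, mul_zero] at hbx
    exact (pow_pos hb0 2).not_ge hbx
  have hK1 : 1 ≤ K := by
    have hK0 : 0 ≤ K := by rw [hK]; positivity
    have h1 : F ^ 2 * l2norm xs ^ 2 ≤ K * (F ^ 2 * l2norm xs ^ 2) :=
      hgapx.trans (by gcongr)
    exact le_of_mul_le_mul_right (by linarith) (mul_pos (pow_pos hF 2) hX)
  have hK0 : 0 < K := by linarith
  have hθ0 : 0 < θ := by linarith
  have hT1 : 6144 ≤ T := by
    rw [hT, le_div_iff₀ (by positivity)]
    have h1 : u ^ 4 ≤ 1 := pow_le_one₀ hu0.le (by linarith)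
    have h2 : 1 ≤ θ * K ^ 2 := one_le_mul_of_one_le_of_one_le hθ1 (one_le_pow₀ hK1)
    linarith
  have hT0 : 0 < T := by linarith
  have hL0 : 0 < L := by rw [hL]; positivity
  have hq0 : 0 < q := by rw [hq]; positivity
  have hq1 : q ≤ 1 / 2 := by
    rw [hq, div_le_iff₀ (by positivity)]
    have h2 : 1 ≤ θ * K := one_le_mul_of_one_le_of_one_le hθ1 hK1
    have h3 : 1 ≤ θ * K * T := one_le_mul_of_one_le_of_one_le h2 (by linarith)
    linarith
  obtain ⟨N, hN⟩ : ∃ N, N = ⌈T⌉₊ := ⟨_, rfl⟩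
  have hTN : T ≤ N := by rw [hN]; exact Nat.le_ceil T
  -- rounding `T` up to the number `N` of steps costs at most a factor `2`, as `T ≥ 6144`
  have hNT : (N : ℝ) ≤ T + 1 := by rw [hN]; exact (Nat.ceil_lt_add_one hT0.le).le
  have hN0 : 0 < N := by
    have : (0 : ℝ) < N := by linarith
    exact_mod_cast this
  obtain ⟨D, hD, hD', hD0, hDle⟩ := exists_first_pow_le hq0 hq1 hδ hδ1
  obtain ⟨μ, hμ, hout, hcost⟩ := RAM.sim_solver (A := A) (b := b) κ γ ε hu hK hθ hc hT hL hq hδ hN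
    hN0 hD hD'
  have hLx : 20 * l2norm xs ^ 2 / u ≤ L := by
    have h1 : F ^ 2 * l2norm xs ^ 2 ≤ K * l2norm b ^ 2 := 
      hgapx.trans (by gcongr; exact l2norm_nonneg _)
    rw [hL, div_le_div_iff₀ hu0 (by positivity)]
    nlinarith
  have hqx : q * (N * L) ≤ l2norm xs ^ 2 / 2 := by
    calc q * (N * L) ≤ q * (2 * T * L) := by gcongr; linarith
      _ = l2norm b ^ 2 / (2 * θ * F ^ 2) := by rw [hq, hL]; field_simp; norm_num
      _ ≤ l2norm xs ^ 2 / 2 := by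
        rw [div_le_div_iff₀ (by positivity) (by norm_num)]
        linarith
  have hw := sum_abs_tapeExp_cutWeight_sub_le hA hgap hK1 hθ1 hbx hu0 (by linarith) hc
    (hT ▸ hTN) (by rw [← hT]; linarith) hLx hL0
  obtain ⟨hsucc, htv⟩ := repeatLaw_attemptLaw_spec hA hL0 hN0 hX hu1 hw hqx hD' hD0
  refine ⟨μ, hμ, fun s hs => ?_, by rw [hout]; exact hsucc, by rw [hout]; exact htv.trans huε⟩
  obtain ⟨h1, h2⟩ := hcost s hs
  intro bound
  suffices htime : (s.time : ℝ) ≤ bound from ⟨le_trans (by exact_mod_cast h1) htime, htime⟩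
  have hv : 1 / u = 2 * (1 / ε + 1) := by rw [hu]; field_simp
  have hP : MvPolynomial.eval ![(k : ℝ), κ, F, 1 / ε, 1 / γ] costPoly =
      1292800 * T ^ 3 * θ * K / u := by
    have e1 : MvPolynomial.eval ![(k : ℝ), κ, F, 1 / ε, 1 / γ] costPoly =
        1292800 * (6144 * (1 / γ) ^ 2 * ((k : ℝ) * κ ^ 2) ^ 2 * (2 * (1 / ε + 1)) ^ 4) ^ 3 *
          (1 / γ) ^ 2 * ((k : ℝ) * κ ^ 2) * (2 * (1 / ε + 1)) := by
      simp [costPoly]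
    rw [e1, ← hv, ← hK, hT, hθ]
    ring
  have hQ : MvPolynomial.eval ![Real.log m, Real.log n] costPolylog =
      (2 * (Real.log m + Real.log n) + 1) ^ 2 := by
    simp [costPolylog]
  have hτ := natCast_accessTime_le (Nat.pos_of_ne_zero hm) (Nat.pos_of_ne_zero hn)
  have hlog : 0 ≤ Real.log (2 / δ) := Real.log_nonneg (by rw [le_div_iff₀ hδ]; linarith)
  calc (s.time : ℝ) ≤ 1010 * RAM.accessTime m n * (N + 1) ^ 2 * (D + 1) := by exact_mod_cast h2
    _ ≤ 1010 * (2 * (Real.log m + Real.log n) + 1) ^ 2 * (2 * T) ^ 2 *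
        (4 / q * Real.log (2 / δ)) := by
      gcongr
      linarith
    _ = bound := by
      change _ = MvPolynomial.eval _ costPoly * MvPolynomial.eval _ costPolylog * _
      rw [hP, hQ, hq]
      field_simp
      ring
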